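/- **Setting.** Let $d\ge 2$, and let a gas mixture have $M\ge 1$ components with molar densities $\mathbf c=(c_1,\dots,c_M)$, $c=\sum_i c_i$, at constant temperature $T>0$. Let $R>0$ be the gas constant, $T_{c,i},P_{c,i}>0$ the critical temperatures and pressures, $\omega_i$ the acentric factors, $\iota_{ij}=\iota_{ji}$, $\iota_{ii}=0$ the binary interaction coefficients, and $$\alpha_i=0.45724\,\tfrac{R^2T_{c,i}^2}{P_{c,i}}\Big[1+\chi_i\big(1-\sqrt{T/T_{c,i}}\big)\Big]^2,\qquad \beta_i=0.07780\,\tfrac{RT_{c,i}}{P_{c,i}},\qquad \beta^*=\max_i\beta_i,$$ with $\chi_i=0.37464+1.54226\,\omega_i-0.26992\,\omega_i^2$ if $\omega_i\le 0.49$ and $\chi_i=0.379642+1.485030\,\omega_i-0.164423\,\omega_i^2+0.016666\,\omega_i^3$ otherwise. The Peng–Robinson free energy density is $$f(\mathbf c)=RT\sum_i c_i(\ln c_i-1)-cRT\ln(1-\beta c)+\frac{\alpha_{\rm mix}c}{2\sqrt2\,\beta}\ln\frac{1+(1-\sqrt2)\beta c}{1+(1+\sqrt2)\beta c},$$ $\alpha_{\rm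 mix}=\sum_{i,j}\frac{c_ic_j}{c^2}\sqrt{\alpha_i\alpha_j}(1-\iota_{ij})$, $\beta=\sum_i\frac{c_i}{c}\beta_i$, and $\mu_i=\partial f/\partial c_i$. Let $\mathcal T_h$ be a finite conforming simplicial triangulation of $\Omega\subset\mathbb R^d$, shape regular with constant $\kappa$ (each $K\in\mathcal T_h$ contains a ball of diameter at least $\operatorname{diam}K/\kappa$). Each interior facet $e\in\mathcal E_h^I$ has size $h_e=\operatorname{diam}e$, adjacent elements $K^\pm$ and unit normal $\boldsymbol n_e$ from $K^+$ to $K^-$; $[\psi]=\psi^+-\psi^-$, $\{\psi\}=\frac12(\psi^++\psi^-)$. Let $\mathcal Q_h$ be the piecewise constants, $\boldsymbol{\mathcal V}_h$ the discontinuous piecewise affine vector fields, and $\boldsymbol{\mathcal U}_h^0$ the $RT_0$ fields in $H(\mathrm{div};\Omega)$ with $\boldsymbol v\cdot\boldsymbol n=0$ on $\partial\Omega$. Differential operators act elementwise, and $(\cdot,\cdot)=\sum_K(\cdot,\cdot)_{L^2(K)}$. Let $\varepsilon(\boldsymbol w)=\frac12(\nabla\boldsymbol w+\nabla\boldsymbol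 w^T)$, $\sigma_e(\boldsymbol w)=\gamma\operatorname{tr}\varepsilon(\boldsymbol w)\,I+2\eta\,\varepsilon(\boldsymbol w)$ with $\eta>0$, $2\eta+d\gamma>0$, and let $\alpha\in\mathbb R$ (Biot constant), $N>0$ (storage modulus), $\varsigma\ge0$, $\varsigma_1$ (penalty parameters). Let $\mathscr D_{i,j}=\hat\phi D_{i,j}$ with $D_{i,j}=D_{j,i}>0$ ($i\ne j$), and $\mathscr D_{i,s}=\frac{\mathcal K}{\eta_i}\big(\frac{\hat\phi}{\phi_r}\big)^3\big(\frac{1-\phi_r}{1-\hat\phi}\big)^2$ with viscosities $\eta_i>0$, $\phi_r\in(0,1)$, an elementwise continuous scalar permeability $\mathcal K>0$, and $\hat\phi\in\mathcal Q_h$ with values in $(0,1)$ (for example $\hat\phi=\phi^n_h$). Let $\mathcal K_e=\frac1{|e|}\int_e\{\mathcal K\}\,ds$. **Scheme.** Write $D_{\tau_n}a^{n+1}=(a^{n+1}-a^n)/\tau_n$. Given level $n$, the values $\boldsymbol w^{n+1}\in\boldsymbol{\mathcal V}_h$, $\boldsymbol u_i^{n+1}\in\boldsymbol{\mathcal U}_h^0$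 $(1\le i\le M)$ and $c_1^{n+1},\dots,c_{M-1}^{n+1},c^{n+1},p^{n+1},\phi^{n+1}\in\mathcal Q_h$ satisfy the equations below, where $c_M:=c-\sum_{i<M}c_i$, where $$\mu_i^{n+1}=\mu_i(\mathbf c^n)+\theta_nRT\frac{c_i^{n+1}-c_i^n}{c^n(1-\beta^*c^n)},\qquad \mu^{n+1}=\sum_i\mu_i(\mathbf c^n)+\theta_nRT\frac{c^{n+1}-c^n}{c^n(1-\beta^*c^n)},$$ and where the upwind value $c_i^{n*}$ on $e$ is $c_i^n|_{K^+}$ if $\boldsymbol u_i^n\cdot\boldsymbol n_e\ge0$ and $c_i^n|_{K^-}$ otherwise. For all $q,z\in\mathcal Q_h$, $\boldsymbol v\in\boldsymbol{\mathcal U}_h^0$, $\boldsymbol\upsilon\in\boldsymbol{\mathcal V}_h$: $$(D_{\tau_n}(\phi^{n+1}c^{n+1}),q)+\sum_{e\in\mathcal E_h^I}\Big\langle\sum_ic_i^{n*}\boldsymbol u_i^{n+1}\cdot\boldsymbol n_e,[q]\Big\rangle_e+\sum_{e\in\mathcal E_h^I}\frac{\varsigma}{h_e}\langle\mathcal K_e[\mu^{n+1}],[q]\rangle_e=0,$$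 $$(D_{\tau_n}(\phi^{n+1}c_i^{n+1}),q)+\sum_{e\in\mathcal E_h^I}\langle c_i^{n*}\boldsymbol u_i^{n+1}\cdot\boldsymbol n_e,[q]\rangle_e+\sum_{e\in\mathcal E_h^I}\frac{\varsigma}{h_e}\langle\mathcal K_e[\mu_i^{n+1}],[q]\rangle_e=0\quad(i<M),$$ $$\sum_{j\ne i}\Big(\frac{c_i^nc_j^n(\boldsymbol u_i^{n+1}-\boldsymbol u_j^{n+1})}{(c^n)^2\mathscr D_{i,j}},\boldsymbol v\Big)+\Big(\frac{\boldsymbol u_i^{n+1}}{\mathscr D_{i,s}},\boldsymbol v\Big)=\sum_{e\in\mathcal E_h^I}\langle[\mu_i^{n+1}],c_i^{n*}\boldsymbol v\cdot\boldsymbol n_e\rangle_e\quad(i\le M),$$ $$(p^{n+1},z)=\Big(\sum_ic_i^n\mu_i^{n+1}-f(\mathbf c^n),z\Big),\qquad \mathcal A(\boldsymbol w^{n+1},p^{n+1},\boldsymbol\upsilon)=0,$$ $$(D_{\tau_n}\phi^{n+1},q)=\tfrac1N(D_{\tau_n}p^{n+1},q)+\alpha(D_{\tau_n}\nabla\cdot\boldsymbol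 w^{n+1},q)-\alpha\sum_{e\in\mathcal E_h^I}\langle\{q\,\boldsymbol n_e\},[D_{\tau_n}\boldsymbol w^{n+1}]\rangle_e,$$ where $$\begin{aligned}\mathcal A(\boldsymbol w,p,\boldsymbol\upsilon)=\;&(\sigma_e(\boldsymbol w),\varepsilon(\boldsymbol\upsilon))-\sum_{e\in\mathcal E_h^I}\langle\{\sigma_e(\boldsymbol w)\boldsymbol n_e\},[\boldsymbol\upsilon]\rangle_e-\alpha(p,\nabla\cdot\boldsymbol\upsilon)+\alpha\sum_{e\in\mathcal E_h^I}\langle\{p\,\boldsymbol n_e\},[\boldsymbol\upsilon]\rangle_e\\&-\sum_{e\in\mathcal E_h^I}\langle[\boldsymbol w],\{\sigma_e(\boldsymbol\upsilon)\boldsymbol n_e\}\rangle_e+\sum_{e\in\mathcal E_h^I}\frac{\varsigma_1}{h_e}\langle[\boldsymbol w],[\boldsymbol\upsilon]\rangle_e\end{aligned}$$ (interior facets only, which expresses the traction-free condition weakly). The discrete energy is $$E_h^n=\sum_K\int_K\Big(\phi^nf(\mathbf c^n)+\tfrac12\sigma_e(\boldsymbol w^n):\varepsilon(\boldsymbol w^n)+\tfrac1{2N}|p^n|^2\Big)dx+\sum_{e\in\mathcal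 E_h^I}\frac{\varsigma_1}{2h_e}\langle[\boldsymbol w^n],[\boldsymbol w^n]\rangle_e-\sum_{e\in\mathcal E_h^I}\langle\{\sigma_e(\boldsymbol w^n)\boldsymbol n_e\},[\boldsymbol w^n]\rangle_e.$$ **Theorem.** Fix $d$, the mixture data, $\gamma,\eta$, a shape-regularity constant $\kappa$, and density bounds $m>0$, $\varrho<1$. There are constants $\varsigma^\star,\theta^\star$, depending on these only, such that for every such mesh, all the remaining data as above with $\varsigma_1\ge\varsigma^\star$, and every $n$ and $\tau_n>0$ with $\theta_n\ge\theta^\star$: if levels $n$ and $n+1$ satisfy the scheme, and at both levels $0<\phi<1$, $c_i\ge m$ $(1\le i\le M)$ and $\beta^*c\le\varrho$, then $$D_{\tau_n}E_h^{n+1}\le 0 .$$ -/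

import Mathlib

open MeasureTheory
open scoped InnerProductSpace ContDiff

noncomputable section

namespace GasFlow

/-! ### Peng–Robinson mixture -/

/-- Physical data of a mixture of `M + 1` components at constant temperature: gas constant,
temperature, critical temperatures and pressures, acentric factors, binary interaction
coefficients. -/
structure Mixture (M : ℕ) where
  R : ℝ
  temp : ℝ
  Tc : Fin (M + 1) → ℝ
  Pc : Fin (M + 1) → ℝ
  acentric : Fin (M + 1) → ℝ
  iota : Fin (M + 1) → Fin (M + 1) → ℝ
  R_pos : 0 < R
  temp_pos : 0 < temp
  Tc_pos : ∀ i, 0 < Tc i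
  Pc_pos : ∀ i, 0 < Pc i
  iota_self : ∀ i, iota i i = 0
  iota_symm : ∀ i j, iota i j = iota j i

namespace Mixture

variable {M : ℕ} (F : Mixture M)

/-- The coefficient `χ_i` as a function of the acentric factor. -/
def chi (i : Fin (M + 1)) : ℝ :=
  if F.acentric i ≤ 0.49 then
    0.37464 + 1.54226 * F.acentric i - 0.26992 * F.acentric i ^ 2
  else
    0.379642 + 1.485030 * F.acentric i - 0.164423 * F.acentric i ^ 2
      + 0.016666 * F.acentric i ^ 3

/-- Pure component energy parameter `α_i`. -/
def alphaPure (i : Fin (M + 1)) : ℝ :=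
  0.45724 * (F.R ^ 2 * F.Tc i ^ 2 / F.Pc i) *
    (1 + F.chi i * (1 - Real.sqrt (F.temp / F.Tc i))) ^ 2

/-- Pure component covolume `β_i`. -/
def betaPure (i : Fin (M + 1)) : ℝ := 0.07780 * (F.R * F.Tc i / F.Pc i)

/-- `β* = max_i β_i`. -/
def betaStar : ℝ := Finset.univ.sup' Finset.univ_nonempty F.betaPure

/-- Total molar density. -/
def total (c : Fin (M + 1) → ℝ) : ℝ := ∑ i, c i

/-- Mixing rule for the energy parameter. -/
def alphaMix (c : Fin (M + 1) → ℝ) : ℝ :=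
  ∑ i, ∑ j, c i * c j / total c ^ 2 *
    Real.sqrt (F.alphaPure i * F.alphaPure j) * (1 - F.iota i j)

/-- Mixing rule for the covolume. -/
def betaMix (c : Fin (M + 1) → ℝ) : ℝ := ∑ i, c i / total c * F.betaPure i

/-- Peng–Robinson Helmholtz free energy density (isothermal, `ζ_c(T) = 0`). -/
def freeEnergy (c : Fin (M + 1) → ℝ) : ℝ :=
  F.R * F.temp * ∑ i, c i * (Real.log (c i) - 1)
    - total c * F.R * F.temp * Real.log (1 - F.betaMix c * total c)
    + F.alphaMix c * total c / (2 * Real.sqrt 2 * F.betaMix c) *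
        Real.log ((1 + (1 - Real.sqrt 2) * F.betaMix c * total c) /
          (1 + (1 + Real.sqrt 2) * F.betaMix c * total c))

/-- Chemical potential `μ_i = ∂f / ∂c_i`. -/
def chemPot (i : Fin (M + 1)) (c : Fin (M + 1) → ℝ) : ℝ :=
  deriv (fun s => F.freeEnergy (Function.update c i s)) (c i)

end Mixture

/-! ### Triangulations -/

/-- Euclidean space of dimension `d`. -/
abbrev E (d : ℕ) := EuclideanSpace ℝ (Fin d)

/-- A conforming simplicial triangulation: a finite geometric simplicial complex, each of whose
simplices is a face of a `d`-simplex. -/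
structure Triangulation (d : ℕ) where
  complex : Geometry.SimplicialComplex ℝ (E d)
  finite_faces : complex.faces.Finite
  pure : ∀ s ∈ complex.faces, ∃ t ∈ complex.faces, t.card = d + 1 ∧ s ⊆ t

namespace Triangulation

variable {d : ℕ} (T : Triangulation d)

/-- The elements, given by their vertex sets. -/
def Cell : Type := {s : Finset (E d) // s ∈ T.complex.faces ∧ s.card = d + 1}

/-- The interior facets: those shared by two elements. -/
def IntFacet : Type :=
  {s : Finset (E d) // (s ∈ T.complex.faces ∧ s.card = d) ∧
    ∃ K K' : T.Cell, K ≠ K' ∧ s ⊆ K.1 ∧ s ⊆ K'.1}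

instance : Finite T.Cell := (T.finite_faces.subset fun _ h => h.1 : Set.Finite _).to_subtype

instance : Finite T.IntFacet :=
  (T.finite_faces.subset fun _ h => h.1.1 : Set.Finite _).to_subtype

instance : Fintype T.Cell := Fintype.ofFinite _

instance : Fintype T.IntFacet := Fintype.ofFinite _

variable {T}

/-- The closed simplex occupied by an element. -/
def Cell.carrier (K : T.Cell) : Set (E d) := convexHull ℝ (K.1 : Set (E d))

/-- The closed `(d - 1)`-simplex occupied by an interior facet. -/
def IntFacet.carrier (e : T.IntFacet) : Set (E d) := convexHull ℝ (e.1 : Set (E d))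

/-- The facet size `h_e`. -/
def IntFacet.size (e : T.IntFacet) : ℝ := Metric.diam e.carrier

variable (T)

/-- The domain `Ω` covered by the triangulation. -/
def domain : Set (E d) := interior T.complex.space

/-- Shape regularity with constant `κ`: every element `K` contains a ball whose diameter `2 r`
satisfies `diam K ≤ κ * (2 r)`. -/
def ShapeRegular (κ : ℝ) : Prop :=
  ∀ K : T.Cell, ∃ x r, 0 < r ∧ Metric.closedBall x r ⊆ K.carrier ∧
    Metric.diam K.carrier ≤ κ * (2 * r)

end Triangulation

/-- A triangulation in which the two elements `K⁺`, `K⁻` adjacent to each interior facet have been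
ordered, together with the unit normal pointing from `K⁺` to `K⁻`. -/
structure Mesh (d : ℕ) extends Triangulation d where
  plus : toTriangulation.IntFacet → toTriangulation.Cell
  minus : toTriangulation.IntFacet → toTriangulation.Cell
  plus_ne_minus : ∀ e, plus e ≠ minus e
  subset_plus : ∀ e, e.1 ⊆ (plus e).1
  subset_minus : ∀ e, e.1 ⊆ (minus e).1
  normal : toTriangulation.IntFacet → E d
  norm_normal : ∀ e, ‖normal e‖ = 1
  normal_plus : ∀ e, ∀ x ∈ e.carrier, ∀ y ∈ (plus e).carrier, ⟪normal e, y - x⟫_ℝ ≤ 0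
  normal_minus : ∀ e, ∀ x ∈ e.carrier, ∀ y ∈ (minus e).carrier, 0 ≤ ⟪normal e, y - x⟫_ℝ

namespace Mesh

variable {d : ℕ} (T : Mesh d)

/-- Elements of the mesh. -/
abbrev Cell := T.toTriangulation.Cell

/-- Interior facets of the mesh. -/
abbrev IntFacet := T.toTriangulation.IntFacet

/-- Integral over `Ω` of an elementwise given function, `∑_K ∫_K g dx`. -/
def cellInt (g : T.Cell → E d → ℝ) : ℝ := ∑ K, ∫ x in K.carrier, g K x

/-- Integral over the interior facets, `∑_{e interior} ∫_e g ds`, with `ds` the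
`(d - 1)`-dimensional surface measure. -/
def facetInt (g : T.IntFacet → E d → ℝ) : ℝ :=
  ∑ e, ∫ x in e.carrier, g e x ∂(μHE[d - 1] : Measure (E d))

variable {T}

/-- Jump `ψ⁺ - ψ⁻` of elementwise traces across an interior facet. -/
def jump {V : Type*} [AddCommGroup V] (ψ : T.Cell → E d → V) (e : T.IntFacet) (x : E d) : V :=
  ψ (T.plus e) x - ψ (T.minus e) x

/-- Average `(ψ⁺ + ψ⁻) / 2` of elementwise traces on an interior facet. -/
def avg {V : Type*} [AddCommGroup V] [Module ℝ V] (ψ : T.Cell → E d → V) (e : T.IntFacet)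
    (x : E d) : V :=
  (2⁻¹ : ℝ) • (ψ (T.plus e) x + ψ (T.minus e) x)

variable (T)

/-! ### Finite element spaces

Elementwise polynomial functions are represented by their polynomial pieces. -/

/-- `Q_h`: piecewise constant functions. -/
abbrev P0 := T.Cell → ℝ

/-- `V_h`: discontinuous piecewise affine vector fields. -/
abbrev P1 := T.Cell → (E d →ᵃ[ℝ] E d)

/-- Elementwise `RT₀(K) = [P₀(K)]^d + x P₀(K)`; the pair `(a, b)` stands for `x ↦ a + b x`. -/
abbrev BrokenRT0 := T.Cell → E d × ℝ

variable {T}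

/-- A piecewise constant function, as an elementwise given function. -/
def P0.eval (q : T.P0) (K : T.Cell) (_x : E d) : ℝ := q K

/-- A piecewise affine field, as an elementwise given function. -/
def P1.eval (w : T.P1) (K : T.Cell) (x : E d) : E d := w K x

/-- An elementwise Raviart–Thomas field, as an elementwise given function. -/
def BrokenRT0.eval (v : T.BrokenRT0) (K : T.Cell) (x : E d) : E d := (v K).1 + (v K).2 • x

/-- Membership in `H(div; Ω)`: the weak divergence is a square integrable function. -/
def BrokenRT0.HDiv (v : T.BrokenRT0) : Prop :=
  ∃ g : E d → ℝ, MemLp g 2 (volume.restrict T.domain) ∧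
    ∀ ψ : E d → ℝ, ContDiff ℝ ∞ ψ → HasCompactSupport ψ → tsupport ψ ⊆ T.domain →
      T.cellInt (fun K x => fderiv ℝ ψ x (v.eval K x)) = - ∫ x in T.domain, g x * ψ x

/-- Vanishing normal component on `∂Ω`, that is, on every facet that belongs to exactly one
element (`ν` ranges over all vectors normal to the facet). -/
def BrokenRT0.NoFlux (v : T.BrokenRT0) : Prop :=
  ∀ s ∈ T.complex.faces, s.card = d → (∃! K : T.Cell, s ⊆ K.1) →
    ∀ K : T.Cell, s ⊆ K.1 → ∀ ν : E d, (∀ x ∈ s, ∀ y ∈ s, ⟪ν, y - x⟫_ℝ = 0) →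
      ∀ x ∈ convexHull ℝ (s : Set (E d)), ⟪ν, v.eval K x⟫_ℝ = 0

/-- `U_h⁰`: the lowest order Raviart–Thomas space with vanishing normal flux on `∂Ω`. -/
def BrokenRT0.MemU0 (v : T.BrokenRT0) : Prop := v.HDiv ∧ v.NoFlux

/-! ### Linear elasticity -/

/-- Gradient of an affine field, `(∇w)_{ij} = ∂_j w_i`. -/
def grad (w : E d →ᵃ[ℝ] E d) : Matrix (Fin d) (Fin d) ℝ :=
  Matrix.of fun i j => w.linear (EuclideanSpace.single j 1) i

/-- Divergence of an affine field. -/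
def dvg (w : E d →ᵃ[ℝ] E d) : ℝ := (grad w).trace

/-- Strain tensor `ε(w) = (∇w + ∇wᵀ) / 2`. -/
def strain (w : E d →ᵃ[ℝ] E d) : Matrix (Fin d) (Fin d) ℝ :=
  (2⁻¹ : ℝ) • (grad w + (grad w).transpose)

/-- Elastic stress `σ_e = γ tr(ε) I + 2 η ε`. -/
def stress (γ η : ℝ) (w : E d →ᵃ[ℝ] E d) : Matrix (Fin d) (Fin d) ℝ :=
  (γ * (strain w).trace) • (1 : Matrix (Fin d) (Fin d) ℝ) + (2 * η) • strain w

/-- Frobenius product `A : B`. -/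
def frob (A B : Matrix (Fin d) (Fin d) ℝ) : ℝ := ∑ i, ∑ j, A i j * B i j

/-- The average traction `{σ_e(w) n_e}` on an interior facet. -/
def avgTraction (γ η : ℝ) (w : T.P1) (e : T.IntFacet) (x : E d) : E d :=
  avg (fun K _ => WithLp.toLp 2 ((stress γ η (w K)).mulVec (T.normal e).ofLp)) e x

/-- The term `{q n_e}` on an interior facet, for piecewise constant `q`. -/
def avgNormal (q : T.P0) (e : T.IntFacet) (x : E d) : E d :=
  avg (fun K x => q.eval K x • T.normal e) e x

/-- The interior penalty form `𝒜(w, p, v)` of the momentum balance; `a` is Biot's constant and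
`ς₁` the penalty parameter. -/
def formA (γ η a ς₁ : ℝ) (w : T.P1) (p : T.P0) (v : T.P1) : ℝ :=
  T.cellInt (fun K _ => frob (stress γ η (w K)) (strain (v K)))
    - T.facetInt (fun e x => ⟪avgTraction γ η w e x, jump v.eval e x⟫_ℝ)
    - a * T.cellInt (fun K _ => p K * dvg (v K))
    + a * T.facetInt (fun e x => ⟪avgNormal p e x, jump v.eval e x⟫_ℝ)
    - T.facetInt (fun e x => ⟪jump w.eval e x, avgTraction γ η v e x⟫_ℝ)
    + T.facetInt (fun e x => ς₁ / e.size * ⟪jump w.eval e x, jump v.eval e x⟫_ℝ)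

end Mesh

/-! ### Maxwell–Stefan–Darcy coefficients -/

/-- Kozeny–Carman factor `κ(φ)` with reference porosity `φr`. -/
def kozenyCarman (φr φ : ℝ) : ℝ := (φ / φr) ^ 3 * ((1 - φr) / (1 - φ)) ^ 2

/-- Data of the Maxwell–Stefan–Darcy model on a mesh: binary diffusion coefficients `D_{i,j}`,
component viscosities, reference porosity, an elementwise continuous positive scalar permeability,
and the piecewise constant porosity at which the scaled coefficients are evaluated. -/
structure Transport {d : ℕ} (T : Mesh d) (M : ℕ) where
  D : Fin (M + 1) → Fin (M + 1) → ℝ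
  D_pos : ∀ i j, i ≠ j → 0 < D i j
  D_symm : ∀ i j, D i j = D j i
  visc : Fin (M + 1) → ℝ
  visc_pos : ∀ i, 0 < visc i
  φr : ℝ
  φr_pos : 0 < φr
  φr_lt_one : φr < 1
  perm : T.Cell → E d → ℝ
  perm_cont : ∀ K, ContinuousOn (perm K) K.carrier
  perm_pos : ∀ K, ∀ x ∈ K.carrier, 0 < perm K x
  φhat : T.P0
  φhat_pos : ∀ K, 0 < φhat K
  φhat_lt_one : ∀ K, φhat K < 1

namespace Transport

variable {d M : ℕ} {T : Mesh d} (P : Transport T M)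

/-- Scaled binary coefficient `𝒟_{i,j} = φ D_{i,j}`. -/
def scaledD (i j : Fin (M + 1)) (K : T.Cell) : ℝ := P.φhat K * P.D i j

/-- Scaled fluid–solid coefficient `𝒟_{i,s} = κ(φ) 𝒦 / η_i`. -/
def scaledDs (i : Fin (M + 1)) (K : T.Cell) (x : E d) : ℝ :=
  kozenyCarman P.φr (P.φhat K) / P.visc i * P.perm K x

/-- The average `𝒦_e` of the permeability on an interior facet. -/
def permFacet (e : T.IntFacet) : ℝ :=
  ⨍ x in e.carrier, Mesh.avg P.perm e x ∂(μHE[d - 1] : Measure (E d))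

end Transport

/-! ### The fully discrete scheme -/

/-- The discrete unknowns at one time level: displacement, the `M + 1` component velocities, the
first `M` component densities, total density, pressure, porosity. -/
structure State {d : ℕ} (T : Mesh d) (M : ℕ) where
  w : T.P1
  u : Fin (M + 1) → T.BrokenRT0
  u_mem : ∀ i, (u i).MemU0
  ci : Fin M → T.P0
  c : T.P0
  p : T.P0
  φ : T.P0

/-- Difference quotient `D_τ a = (a₁ - a₀) / τ`. -/
def Dτ {V : Type*} [AddCommGroup V] [Module ℝ V] (τ : ℝ) (a₁ a₀ : V) : V := τ⁻¹ • (a₁ - a₀)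

namespace State

variable {d M : ℕ} {T : Mesh d}

/-- All `M + 1` component densities on an element, the last one being recovered as
`c - ∑_{i ≤ M} c_i`. -/
def dens (X : State T M) (K : T.Cell) : Fin (M + 1) → ℝ :=
  Fin.snoc (fun i => X.ci i K) (X.c K - ∑ i, X.ci i K)

/-- Component density `c_i` as a piecewise constant function. -/
def comp (X : State T M) (i : Fin (M + 1)) : T.P0 := fun K => X.dens K i

/-- Bounds: porosity in `(0, 1)`, component densities at least `m`, and `β* c ≤ ϱ`. -/
def Bounded (F : Mixture M) (m ϱ : ℝ) (X : State T M) : Prop :=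
  ∀ K, (0 < X.φ K ∧ X.φ K < 1) ∧ (∀ i, m ≤ X.dens K i) ∧ F.betaStar * X.c K ≤ ϱ

/-- Stabilized chemical potential `μ_i^{n+1}`; `X₀`, `X₁` are the states at levels `n`, `n + 1`. -/
def chem (F : Mixture M) (θ : ℝ) (X₀ X₁ : State T M) (i : Fin (M + 1)) : T.P0 := fun K =>
  F.chemPot i (X₀.dens K) +
    θ * F.R * F.temp * ((X₁.dens K i - X₀.dens K i) / (X₀.c K * (1 - F.betaStar * X₀.c K)))

/-- Stabilized total chemical potential `μ^{n+1}`. -/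
def chemTotal (F : Mixture M) (θ : ℝ) (X₀ X₁ : State T M) : T.P0 := fun K =>
  ∑ i, F.chemPot i (X₀.dens K) +
    θ * F.R * F.temp * ((X₁.c K - X₀.c K) / (X₀.c K * (1 - F.betaStar * X₀.c K)))

/-- Upwind density `c_i^{n*}` on an interior facet. -/
def upwind (X₀ : State T M) (i : Fin (M + 1)) (e : T.IntFacet) (x : E d) : ℝ :=
  if 0 ≤ ⟪(X₀.u i).eval (T.plus e) x, T.normal e⟫_ℝ then X₀.comp i (T.plus e)
  else X₀.comp i (T.minus e)

/-- Normal flux `v · n_e` on an interior facet (single valued, since `v ∈ H(div)`). -/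
def flux (v : T.BrokenRT0) (e : T.IntFacet) (x : E d) : ℝ :=
  ⟪v.eval (T.plus e) x, T.normal e⟫_ℝ

/-- `X₁` solves the fully discrete scheme with time step `τ`, starting from `X₀`. Here `θ` is the
stabilization parameter, `γ, η` are the Lamé parameters, `a` is Biot's constant, `N` the storage
modulus, and `ς, ς₁` are the penalty parameters. -/
structure IsStep (F : Mixture M) (P : Transport T M) (γ η a N ς ς₁ τ θ : ℝ)
    (X₀ X₁ : State T M) : Prop where
  mass_total : ∀ q : T.P0,
    T.cellInt (fun K _ => Dτ τ (X₁.φ K * X₁.c K) (X₀.φ K * X₀.c K) * q K)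
      + T.facetInt (fun e x => (∑ i, X₀.upwind i e x * flux (X₁.u i) e x) * Mesh.jump q.eval e x)
      + T.facetInt (fun e x => ς / e.size *
          (P.permFacet e * Mesh.jump (chemTotal F θ X₀ X₁).eval e x * Mesh.jump q.eval e x)) = 0
  mass_comp : ∀ (i : Fin M) (q : T.P0),
    T.cellInt (fun K _ => Dτ τ (X₁.φ K * X₁.ci i K) (X₀.φ K * X₀.ci i K) * q K)
      + T.facetInt (fun e x => X₀.upwind i.castSucc e x * flux (X₁.u i.castSucc) e x *
          Mesh.jump q.eval e x)
      + T.facetInt (fun e x => ς / e.size *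
          (P.permFacet e * Mesh.jump (chem F θ X₀ X₁ i.castSucc).eval e x *
            Mesh.jump q.eval e x)) = 0
  maxwell_stefan : ∀ (i : Fin (M + 1)) (v : T.BrokenRT0), v.MemU0 →
    ∑ j ∈ Finset.univ.erase i, T.cellInt (fun K x =>
        X₀.dens K i * X₀.dens K j / (X₀.c K ^ 2 * P.scaledD i j K) *
          ⟪(X₁.u i).eval K x - (X₁.u j).eval K x, v.eval K x⟫_ℝ)
      + T.cellInt (fun K x => 1 / P.scaledDs i K x * ⟪(X₁.u i).eval K x, v.eval K x⟫_ℝ)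
      = T.facetInt (fun e x => Mesh.jump (chem F θ X₀ X₁ i).eval e x *
          (X₀.upwind i e x * flux v e x))
  pressure : ∀ z : T.P0,
    T.cellInt (fun K _ => X₁.p K * z K)
      = T.cellInt (fun K _ =>
          (∑ i, X₀.dens K i * chem F θ X₀ X₁ i K - F.freeEnergy (X₀.dens K)) * z K)
  momentum : ∀ v : T.P1, Mesh.formA γ η a ς₁ X₁.w X₁.p v = 0
  porosity : ∀ q : T.P0,
    T.cellInt (fun K _ => Dτ τ (X₁.φ K) (X₀.φ K) * q K)
      = 1 / N * T.cellInt (fun K _ => Dτ τ (X₁.p K) (X₀.p K) * q K)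
        + a * T.cellInt (fun K _ => Dτ τ (Mesh.dvg (X₁.w K)) (Mesh.dvg (X₀.w K)) * q K)
        - a * T.facetInt (fun e x => ⟪Mesh.avgNormal q e x,
            Mesh.jump (Mesh.P1.eval (Dτ τ X₁.w X₀.w)) e x⟫_ℝ)

/-- The discrete total free energy `E_h`. -/
def energy (F : Mixture M) (γ η N ς₁ : ℝ) (X : State T M) : ℝ :=
  T.cellInt (fun K _ => X.φ K * F.freeEnergy (X.dens K)
      + 1 / 2 * Mesh.frob (Mesh.stress γ η (X.w K)) (Mesh.strain (X.w K))
      + 1 / (2 * N) * |X.p K| ^ 2)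
    + T.facetInt (fun e x => ς₁ / (2 * e.size) *
        ⟪Mesh.jump X.w.eval e x, Mesh.jump X.w.eval e x⟫_ℝ)
    - T.facetInt (fun e x => ⟪Mesh.avgTraction γ η X.w e x, Mesh.jump X.w.eval e x⟫_ℝ)

end State

end GasFlow

end

open MeasureTheory
open scoped InnerProductSpace ContDiff

noncomputable section

/-! The energy is a sum of a fluid part, half of the symmetric interior penalty form `elasticForm`
at `(w, w)`, and a quadratic pressure part; each is bounded by the terms that the scheme produces
when tested with suitable functions.

Fluid: the Peng–Robinson energy is `C²` on the compact convex set of admissible densities, so it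
deviates from its tangent plane by at most `L |c₁ - c₀|²`. For large `θ` the stabilization absorbs
this remainder (`exists_stabilization`), whence `f(c₁) - f(c₀) ≤ ∑ (c₁ᵢ - c₀ᵢ) μᵢ`. Expanding `D(φ
cᵢ)` with the new porosity on the density increment gives, in every element, `D(φ f) ≤ ∑ D(φ cᵢ) μᵢ
- p₁ Dφ`, because `p₁ = ∑ c₀ᵢ μᵢ - f(c₀)`. The first sum integrates to a nonpositive number: test
each mass balance with `μᵢ` and each Maxwell–Stefan–Darcy equation with `uᵢ`; the upwind terms then
equal friction, which is nonnegative (`sum_chem_nonpos`).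

Solid: porosity tested with `p₁` and momentum tested with `Dw` turn `∫ p₁ Dφ` into `(1/N) ∫ p₁ Dp`
plus the elastic form at `(w₁, Dw)`. These dominate the increments of the pressure and elastic
energies, by the identity `x² - y² = 2x(x - y) - (x - y)²` and its analogue for a symmetric form
that is nonnegative on the diagonal. That nonnegativity is where a large `ς₁` is needed
(`elasticForm_self_nonneg`). Adding everything (`energy_le`), the coupling terms cancel. -/

namespace GasFlow

/-! ### Geometry of facets and elements. -/

namespace Triangulation

variable {d : ℕ} {T : Triangulation d}

lemma Cell.isCompact_carrier (K : T.Cell) : IsCompact K.carrier :=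
  K.1.finite_toSet.isCompact_convexHull (𝕜 := ℝ)

lemma IntFacet.isCompact_carrier (e : T.IntFacet) : IsCompact e.carrier :=
  e.1.finite_toSet.isCompact_convexHull (𝕜 := ℝ)

lemma IntFacet.carrier_subset (e : T.IntFacet) (K : T.Cell) (h : e.1 ⊆ K.1) :
    e.carrier ⊆ K.carrier :=
  convexHull_mono (by exact_mod_cast h)

lemma IntFacet.size_nonneg (e : T.IntFacet) : 0 ≤ e.size := Metric.diam_nonneg

lemma IntFacet.size_pos (hd : 2 ≤ d) (e : T.IntFacet) : 0 < e.size := by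
  have hcard : 1 < e.1.card := by rw [e.2.1.2]; omega
  obtain ⟨x, hx, y, hy, hxy⟩ := Finset.one_lt_card.mp hcard
  exact (dist_pos.mpr hxy).trans_le (Metric.dist_le_diam_of_mem e.isCompact_carrier.isBounded
    (subset_convexHull ℝ _ hx) (subset_convexHull ℝ _ hy))

/-- A facet is contained in an isometric copy of a `(d - 1)`-dimensional ball of radius `h_e`. -/
lemma IntFacet.surface_le (hd : 2 ≤ d) (e : T.IntFacet) :
    (μHE[d - 1] : Measure (E d)) e.carrier ≤
      volume (Metric.closedBall (0 : E (d - 1)) e.size) := by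
  obtain ⟨p, hp⟩ := T.complex.nonempty_of_mem_faces e.2.1.1
  have hspan : Module.finrank ℝ (vectorSpan ℝ (e.1 : Set (E d))) = d - 1 := by
    have h := (T.complex.indep e.2.1.1).finrank_vectorSpan (n := d - 1)
      (by rw [Fintype.card_coe, e.2.1.2]; omega)
    rw [← h]
    congr 2 <;> simp
  -- An orthonormal basis of the facet's direction space gives an isometric chart, which preserves
  -- Hausdorff measure and so reduces the bound to Lebesgue measure in dimension `d - 1`.
  let φ : E (d - 1) ≃ₗᵢ[ℝ] vectorSpan ℝ (e.1 : Set (E d)) :=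
    ((stdOrthonormalBasis ℝ (vectorSpan ℝ (e.1 : Set (E d)))).reindex (finCongr hspan)).repr.symm
  let g : E (d - 1) → E d := fun y => (φ y : E d) + p
  have hg : Isometry g := by
    refine Isometry.of_dist_eq fun x y => ?_
    simp only [g, dist_add_right]
    exact φ.isometry.dist_eq x y
  -- The ball is centred at the vertex `p`; every point of the facet is within `h_e` of it.
  have hsub : e.carrier ⊆ g '' Metric.closedBall 0 e.size := by
    intro x hx
    have hpc : p ∈ e.carrier := subset_convexHull ℝ _ hp
    have hxs : x - p ∈ vectorSpan ℝ (e.1 : Set (E d)) := by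
      rw [← direction_affineSpan]
      exact AffineSubspace.vsub_mem_direction (convexHull_subset_affineSpan _ hx)
        (convexHull_subset_affineSpan _ hpc)
    refine ⟨φ.symm ⟨x - p, hxs⟩, ?_, by simp [g]⟩
    rw [mem_closedBall_zero_iff, LinearIsometryEquiv.norm_map, Submodule.coe_norm,
      ← dist_eq_norm]
    exact Metric.dist_le_diam_of_mem e.isCompact_carrier.isBounded hx hpc
  calc (μHE[d - 1] : Measure (E d)) e.carrier
      ≤ (μHE[d - 1] : Measure (E d)) (g '' Metric.closedBall 0 e.size) := measure_mono hsub
    _ = volume (Metric.closedBall (0 : E (d - 1)) e.size) := by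
      rw [hg.euclideanHausdorffMeasure_image, EuclideanSpace.euclideanHausdorffMeasure_eq_volume]

lemma IntFacet.surface_lt_top (hd : 2 ≤ d) (e : T.IntFacet) :
    (μHE[d - 1] : Measure (E d)) e.carrier < ⊤ :=
  (e.surface_le hd).trans_lt measure_closedBall_lt_top

lemma IntFacet.integrableOn_of_continuous (hd : 2 ≤ d) (e : T.IntFacet) {g : E d → ℝ}
    (hg : Continuous g) : IntegrableOn g e.carrier (μHE[d - 1] : Measure (E d)) := by
  obtain ⟨C, hC⟩ := e.isCompact_carrier.exists_bound_of_continuousOn hg.continuousOn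
  exact Measure.integrableOn_of_bounded (e.surface_lt_top hd).ne hg.aestronglyMeasurable
    ((ae_restrict_iff' e.isCompact_carrier.measurableSet).mpr (.of_forall hC))

/-- The constant of the geometric inequality `h_e |e| ≤ C |K|`. -/
def facetConst (d : ℕ) (κ : ℝ) : ℝ :=
  volume.real (Metric.ball (0 : E (d - 1)) 1) * (2 * κ) ^ d /
    volume.real (Metric.ball (0 : E d) 1)

/-- This replaces a trace inequality: stresses are constant on elements, so only measures have to be
compared. Since `|e| ≤ b h_e^(d-1)`, the left side is at most `b h_e^d`, and shape regularity bounds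
`h_e ≤ diam K` by `2κ` times the radius of an inscribed ball. -/
lemma IntFacet.size_mul_surface_le (hd : 2 ≤ d) {κ : ℝ} (hT : T.ShapeRegular κ)
    (e : T.IntFacet) (K : T.Cell) (h : e.1 ⊆ K.1) :
    e.size * (μHE[d - 1] : Measure (E d)).real e.carrier ≤
      facetConst d κ * volume.real K.carrier := by
  obtain ⟨x, r, hr, hball, hdiam⟩ := hT K
  have hsz : e.size ≤ 2 * κ * r := by
    calc e.size ≤ Metric.diam K.carrier :=
          Metric.diam_mono (e.carrier_subset K h) K.isCompact_carrier.isBounded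
      _ ≤ 2 * κ * r := by linarith
  set b := volume.real (Metric.ball (0 : E (d - 1)) 1)
  set B := volume.real (Metric.ball (0 : E d) 1) with hB
  have hb : 0 ≤ b := measureReal_nonneg
  have hBpos : 0 < B := ENNReal.toReal_pos (Metric.measure_ball_pos _ _ one_pos).ne'
    measure_ball_lt_top.ne
  have h1 : (μHE[d - 1] : Measure (E d)).real e.carrier ≤ e.size ^ (d - 1) * b := by
    have := ENNReal.toReal_mono measure_closedBall_lt_top.ne (e.surface_le hd)
    have h2 := Measure.addHaar_real_closedBall (volume : Measure (E (d - 1))) 0 e.size_nonneg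
    rw [finrank_euclideanSpace_fin] at h2
    rw [← h2]
    exact this
  have h2 : r ^ d * B ≤ volume.real K.carrier := by
    have h2 := Measure.addHaar_real_closedBall (volume : Measure (E d)) x hr.le
    rw [finrank_euclideanSpace_fin] at h2
    rw [← h2]
    exact measureReal_mono hball K.isCompact_carrier.measure_lt_top.ne
  -- The sign of `κ` is not assumed; here it follows from `0 ≤ h_e ≤ 2κr` and `r > 0`.
  have hκ : 0 ≤ κ := by
    by_contra hκ
    have := e.size_nonneg
    nlinarith [mul_pos (neg_pos.mpr (not_le.mp hκ)) hr]
  calc e.size * (μHE[d - 1] : Measure (E d)).real e.carrier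
      ≤ e.size * (e.size ^ (d - 1) * b) := mul_le_mul_of_nonneg_left h1 e.size_nonneg
    _ = e.size ^ d * b := by
      rw [← mul_assoc, ← pow_succ']
      congr 2
      omega
    _ ≤ (2 * κ * r) ^ d * b :=
      mul_le_mul_of_nonneg_right (pow_le_pow_left₀ e.size_nonneg hsz d) hb
    _ = facetConst d κ * (r ^ d * B) := by
      simp only [facetConst]
      rw [← hB, mul_pow]
      field_simp
      ring
    _ ≤ facetConst d κ * volume.real K.carrier := by
      refine mul_le_mul_of_nonneg_left h2 ?_
      simp only [facetConst]
      positivity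

end Triangulation

/-! ### Linearity and positivity of elementwise and facetwise integrals. -/

namespace Mesh

variable {d : ℕ} {T : Mesh d}

/-- A function given facetwise is integrable on every interior facet. -/
def FacetIntegrable (g : T.IntFacet → E d → ℝ) : Prop :=
  ∀ e, IntegrableOn (g e) e.carrier (μHE[d - 1] : Measure (E d))

/-- A function given elementwise is integrable on every element. -/
def CellIntegrable (g : T.Cell → E d → ℝ) : Prop :=
  ∀ K, IntegrableOn (g K) K.carrier

lemma facetIntegrable_of_continuous (hd : 2 ≤ d) {g : T.IntFacet → E d → ℝ}
    (hg : ∀ e, Continuous (g e)) : FacetIntegrable g :=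
  fun e => e.integrableOn_of_continuous hd (hg e)

lemma cellIntegrable_of_continuousOn {g : T.Cell → E d → ℝ}
    (hg : ∀ K, ContinuousOn (g K) K.carrier) : CellIntegrable g :=
  fun K => (hg K).integrableOn_compact K.isCompact_carrier

lemma facetInt_add {f g : T.IntFacet → E d → ℝ} (hf : FacetIntegrable f)
    (hg : FacetIntegrable g) :
    T.facetInt (fun e x => f e x + g e x) = T.facetInt f + T.facetInt g := by
  simp only [facetInt, ← Finset.sum_add_distrib]
  exact Finset.sum_congr rfl fun e _ => integral_add (hf e) (hg e)

lemma facetInt_const_mul (c : ℝ) (f : T.IntFacet → E d → ℝ) :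
    T.facetInt (fun e x => c * f e x) = c * T.facetInt f := by
  simp only [facetInt, Finset.mul_sum]
  exact Finset.sum_congr rfl fun e _ => integral_const_mul c (f e)

lemma facetInt_sub {f g : T.IntFacet → E d → ℝ} (hf : FacetIntegrable f)
    (hg : FacetIntegrable g) :
    T.facetInt (fun e x => f e x - g e x) = T.facetInt f - T.facetInt g := by
  simp only [facetInt, ← Finset.sum_sub_distrib]
  exact Finset.sum_congr rfl fun e _ => integral_sub (hf e) (hg e)

lemma facetInt_sum {ι : Type*} (s : Finset ι) {f : ι → T.IntFacet → E d → ℝ}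
    (hf : ∀ i, FacetIntegrable (f i)) :
    T.facetInt (fun e x => ∑ i ∈ s, f i e x) = ∑ i ∈ s, T.facetInt (f i) := by
  simp only [facetInt]
  rw [Finset.sum_comm]
  exact Finset.sum_congr rfl fun e _ => integral_finsetSum s fun i _ => hf i e

lemma facetInt_nonneg {f : T.IntFacet → E d → ℝ} (hf : ∀ e, ∀ x ∈ e.carrier, 0 ≤ f e x) :
    0 ≤ T.facetInt f :=
  Finset.sum_nonneg fun e _ => setIntegral_nonneg e.isCompact_carrier.measurableSet (hf e)

lemma cellInt_add {f g : T.Cell → E d → ℝ} (hf : CellIntegrable f) (hg : CellIntegrable g) :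
    T.cellInt (fun K x => f K x + g K x) = T.cellInt f + T.cellInt g := by
  simp only [cellInt, ← Finset.sum_add_distrib]
  exact Finset.sum_congr rfl fun K _ => integral_add (hf K) (hg K)

lemma cellInt_nonneg {f : T.Cell → E d → ℝ} (hf : ∀ K, ∀ x ∈ K.carrier, 0 ≤ f K x) :
    0 ≤ T.cellInt f :=
  Finset.sum_nonneg fun K _ => setIntegral_nonneg K.isCompact_carrier.measurableSet (hf K)

lemma cellInt_const (g : T.Cell → ℝ) :
    T.cellInt (fun K _ => g K) = ∑ K, volume.real K.carrier * g K := by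
  simp [cellInt]

end Mesh

/-! ### Tensor algebra of strain and stress. -/

namespace Mesh

variable {d : ℕ}

section Tensors

lemma frob_comm (A B : Matrix (Fin d) (Fin d) ℝ) : frob A B = frob B A := by
  simp [frob, mul_comm]

lemma frob_add_left (A B C : Matrix (Fin d) (Fin d) ℝ) :
    frob (A + B) C = frob A C + frob B C := by
  simp [frob, add_mul, Finset.sum_add_distrib]

lemma frob_sub_right (A B C : Matrix (Fin d) (Fin d) ℝ) :
    frob A (B - C) = frob A B - frob A C := by
  simp [frob, mul_sub, Finset.sum_sub_distrib]

lemma frob_smul_left (r : ℝ) (A B : Matrix (Fin d) (Fin d) ℝ) :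
    frob (r • A) B = r * frob A B := by
  simp [frob, mul_assoc, Finset.mul_sum]

lemma frob_smul_right (r : ℝ) (A B : Matrix (Fin d) (Fin d) ℝ) :
    frob A (r • B) = r * frob A B := by
  rw [frob_comm, frob_smul_left, frob_comm]

lemma frob_one_left (A : Matrix (Fin d) (Fin d) ℝ) : frob 1 A = A.trace := by
  simp [frob, Matrix.one_apply, Matrix.trace]

lemma frob_self_nonneg (A : Matrix (Fin d) (Fin d) ℝ) : 0 ≤ frob A A :=
  Finset.sum_nonneg fun _ _ => Finset.sum_nonneg fun _ _ => mul_self_nonneg _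

lemma trace_sq_le (A : Matrix (Fin d) (Fin d) ℝ) : A.trace ^ 2 ≤ d * frob A A := by
  have h := sq_sum_le_card_mul_sum_sq (s := Finset.univ) (f := fun i => A i i)
  rw [Finset.card_univ, Fintype.card_fin] at h
  refine h.trans (mul_le_mul_of_nonneg_left (Finset.sum_le_sum fun i _ => ?_) d.cast_nonneg)
  rw [pow_two]
  exact Finset.single_le_sum (f := fun j => A i j * A i j) (fun _ _ => mul_self_nonneg _)
    (Finset.mem_univ i)

lemma norm_mulVec_sq_le (A : Matrix (Fin d) (Fin d) ℝ) (x : E d) :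
    ‖(WithLp.toLp 2 (A.mulVec x.ofLp) : E d)‖ ^ 2 ≤ frob A A * ‖x‖ ^ 2 := by
  rw [EuclideanSpace.norm_sq_eq, EuclideanSpace.norm_sq_eq, frob, Finset.sum_mul]
  refine Finset.sum_le_sum fun i _ => ?_
  simp only [Real.norm_eq_abs, sq_abs, Matrix.mulVec, dotProduct]
  refine (Finset.sum_mul_sq_le_sq_mul_sq _ _ _).trans (le_of_eq ?_)
  simp [pow_two]

variable (γ η : ℝ)

lemma grad_sub (v w : E d →ᵃ[ℝ] E d) : grad (v - w) = grad v - grad w := by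
  ext i j
  simp [grad]

lemma grad_smul (r : ℝ) (v : E d →ᵃ[ℝ] E d) : grad (r • v) = r • grad v := by
  ext i j
  simp [grad]

lemma dvg_sub (v w : E d →ᵃ[ℝ] E d) : dvg (v - w) = dvg v - dvg w := by
  simp [dvg, grad_sub]

lemma dvg_smul (r : ℝ) (v : E d →ᵃ[ℝ] E d) : dvg (r • v) = r * dvg v := by
  simp [dvg, grad_smul]

lemma strain_sub (v w : E d →ᵃ[ℝ] E d) : strain (v - w) = strain v - strain w := by
  simp only [strain, grad_sub, Matrix.transpose_sub]
  module

lemma strain_smul (r : ℝ) (v : E d →ᵃ[ℝ] E d) : strain (r • v) = r • strain v := by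
  simp only [strain, grad_smul, Matrix.transpose_smul]
  module

lemma stress_sub (v w : E d →ᵃ[ℝ] E d) :
    stress γ η (v - w) = stress γ η v - stress γ η w := by
  simp only [stress, strain_sub, Matrix.trace_sub]
  module

lemma stress_smul (r : ℝ) (v : E d →ᵃ[ℝ] E d) : stress γ η (r • v) = r • stress γ η v := by
  simp only [stress, strain_smul, Matrix.trace_smul, smul_eq_mul]
  module

lemma frob_stress_left (v : E d →ᵃ[ℝ] E d) (A : Matrix (Fin d) (Fin d) ℝ) :
    frob (stress γ η v) A = γ * (strain v).trace * A.trace + 2 * η * frob (strain v) A := by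
  rw [stress, frob_add_left, frob_smul_left, frob_smul_left, frob_one_left]

lemma frob_stress_strain_comm (v w : E d →ᵃ[ℝ] E d) :
    frob (stress γ η v) (strain w) = frob (stress γ η w) (strain v) := by
  rw [frob_stress_left, frob_stress_left, frob_comm (strain v)]
  ring

/-- Coercivity constant of the elastic energy density. -/
def elasticLower (d : ℕ) (γ η : ℝ) : ℝ := min (2 * η) (2 * η + d * γ)

/-- Constant bounding the squared stress by the squared strain. -/
def stressConst (d : ℕ) (γ η : ℝ) : ℝ := (γ ^ 2 * d + 4 * η * |γ|) * d + 4 * η ^ 2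

/-- For `γ ≥ 0` the trace term can be dropped; for `γ ≤ 0` it is controlled by `(tr ε)² ≤ d ε : ε`.
The two cases give the two entries of the minimum. -/
lemma elasticLower_mul_le (v : E d →ᵃ[ℝ] E d) :
    elasticLower d γ η * frob (strain v) (strain v) ≤ frob (stress γ η v) (strain v) := by
  rw [frob_stress_left]
  have hF := frob_self_nonneg (strain v)
  have ht := trace_sq_le (strain v)
  rcases le_total 0 γ with h | h
  · have := mul_le_mul_of_nonneg_right (min_le_left (2 * η) (2 * η + d * γ)) hF
    have h2 := mul_nonneg h (sq_nonneg (strain v).trace)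
    simp only [elasticLower]
    linarith
  · have := mul_le_mul_of_nonneg_right (min_le_right (2 * η) (2 * η + d * γ)) hF
    have h2 := mul_le_mul_of_nonpos_left ht h
    simp only [elasticLower]
    linarith

lemma frob_stress_self_le (hη : 0 < η) (v : E d →ᵃ[ℝ] E d) :
    frob (stress γ η v) (stress γ η v) ≤
      stressConst d γ η * frob (strain v) (strain v) := by
  have htr : (stress γ η v).trace = (γ * d + 2 * η) * (strain v).trace := by
    simp only [stress, Matrix.trace_add, Matrix.trace_smul, Matrix.trace_one, Fintype.card_fin,
      smul_eq_mul]
    ring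
  -- The coefficient of `(tr ε)²` may be negative when `γ < 0`, hence `|γ|` in `stressConst`.
  have heq : frob (stress γ η v) (stress γ η v) =
      (γ ^ 2 * d + 4 * η * γ) * (strain v).trace ^ 2
        + 4 * η ^ 2 * frob (strain v) (strain v) := by
    rw [frob_stress_left, htr, frob_comm (strain v), frob_stress_left]
    ring
  have h1 : (γ ^ 2 * d + 4 * η * γ) * (strain v).trace ^ 2 ≤
      (γ ^ 2 * d + 4 * η * |γ|) * (d * frob (strain v) (strain v)) := by
    refine mul_le_mul ?_ (trace_sq_le _) (sq_nonneg _) (by positivity)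
    nlinarith [le_abs_self γ]
  rw [heq, stressConst]
  linarith

end Tensors

/-! ### The interior penalty form and its coercivity. -/

section Form

variable {T : Mesh d}

lemma P1.continuous_eval (w : T.P1) (K : T.Cell) : Continuous (w.eval K) :=
  (w K).continuous_of_finiteDimensional

lemma continuous_jump {V : Type*} [NormedAddCommGroup V] {ψ : T.Cell → E d → V}
    (h : ∀ K, Continuous (ψ K)) (e : T.IntFacet) : Continuous (jump ψ e) :=
  (h _).sub (h _)

lemma jump_sub (w v : T.P1) (e : T.IntFacet) (x : E d) :
    jump (P1.eval (w - v)) e x = jump w.eval e x - jump v.eval e x := by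
  simp only [jump, P1.eval, Pi.sub_apply, AffineMap.coe_sub]
  abel

lemma jump_smul (r : ℝ) (w : T.P1) (e : T.IntFacet) (x : E d) :
    jump (P1.eval (r • w)) e x = r • jump w.eval e x := by
  simp only [jump, P1.eval, Pi.smul_apply, AffineMap.coe_smul, smul_sub]

variable (γ η : ℝ)

lemma avgTraction_sub (w v : T.P1) (e : T.IntFacet) (x : E d) :
    avgTraction γ η (w - v) e x = avgTraction γ η w e x - avgTraction γ η v e x := by
  simp only [avgTraction, avg, Pi.sub_apply, stress_sub, Matrix.sub_mulVec, WithLp.toLp_sub]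
  module

lemma avgTraction_smul (r : ℝ) (w : T.P1) (e : T.IntFacet) (x : E d) :
    avgTraction γ η (r • w) e x = r • avgTraction γ η w e x := by
  simp only [avgTraction, avg, Pi.smul_apply, stress_smul, Matrix.smul_mulVec, WithLp.toLp_smul]
  module

lemma continuous_avgTraction (w : T.P1) (e : T.IntFacet) :
    Continuous (avgTraction γ η w e) :=
  continuous_const

/-- The symmetric interior penalty form of linear elasticity. -/
def elasticForm (ς₁ : ℝ) (w v : T.P1) : ℝ :=
  T.cellInt (fun K _ => frob (stress γ η (w K)) (strain (v K)))
    - T.facetInt (fun e x => ⟪avgTraction γ η w e x, jump v.eval e x⟫_ℝ)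
    - T.facetInt (fun e x => ⟪jump w.eval e x, avgTraction γ η v e x⟫_ℝ)
    + T.facetInt (fun e x => ς₁ / e.size * ⟪jump w.eval e x, jump v.eval e x⟫_ℝ)

/-- The discrete pairing of the pressure with the divergence. -/
def pressureForm (p : T.P0) (v : T.P1) : ℝ :=
  T.cellInt (fun K _ => p K * dvg (v K))
    - T.facetInt (fun e x => ⟪avgNormal p e x, jump v.eval e x⟫_ℝ)

lemma formA_eq (a ς₁ : ℝ) (w : T.P1) (p : T.P0) (v : T.P1) :
    T.formA γ η a ς₁ w p v = elasticForm γ η ς₁ w v - a * pressureForm p v := by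
  simp only [formA, elasticForm, pressureForm]
  ring

lemma elasticForm_comm (ς₁ : ℝ) (w v : T.P1) :
    elasticForm γ η ς₁ w v = elasticForm γ η ς₁ v w := by
  simp only [elasticForm, frob_stress_strain_comm γ η (w _) (v _),
    real_inner_comm (jump v.eval _ _), real_inner_comm (avgTraction γ η v _ _)]
  simp only [real_inner_comm]
  ring

lemma elasticForm_sub_right (hd : 2 ≤ d) (ς₁ : ℝ) (w v v' : T.P1) :
    elasticForm γ η ς₁ w (v - v') = elasticForm γ η ς₁ w v - elasticForm γ η ς₁ w v' := by
  have hj : ∀ (u : T.P1) e, Continuous (jump u.eval e) :=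
    fun u => continuous_jump u.continuous_eval
  have ht : ∀ (u : T.P1) e, Continuous (avgTraction γ η u e) := continuous_avgTraction γ η
  simp only [elasticForm, jump_sub, avgTraction_sub, Pi.sub_apply, strain_sub, frob_sub_right,
    inner_sub_right, mul_sub]
  rw [facetInt_sub, facetInt_sub, facetInt_sub, cellInt_const, cellInt_const, cellInt_const]
  · simp only [mul_sub, Finset.sum_sub_distrib]
    ring
  all_goals
    refine facetIntegrable_of_continuous hd fun e => ?_
    have := hj w e
    have := hj v e
    have := hj v' e
    have := ht w e
    have := ht v e
    have := ht v' e
    fun_prop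

lemma elasticForm_smul_right (ς₁ r : ℝ) (w v : T.P1) :
    elasticForm γ η ς₁ w (r • v) = r * elasticForm γ η ς₁ w v := by
  simp only [elasticForm, jump_smul, avgTraction_smul, Pi.smul_apply, strain_smul,
    frob_smul_right, inner_smul_right, mul_left_comm _ r, facetInt_const_mul, cellInt_const,
    ← Finset.mul_sum]
  ring

lemma norm_avgTraction_sq_le (w : T.P1) (e : T.IntFacet) (x : E d) :
    ‖avgTraction γ η w e x‖ ^ 2 ≤
      2⁻¹ * (frob (stress γ η (w (T.plus e))) (stress γ η (w (T.plus e)))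
        + frob (stress γ η (w (T.minus e))) (stress γ η (w (T.minus e)))) := by
  have h1 := norm_mulVec_sq_le (stress γ η (w (T.plus e))) (T.normal e)
  have h2 := norm_mulVec_sq_le (stress γ η (w (T.minus e))) (T.normal e)
  rw [T.norm_normal, one_pow, mul_one] at h1 h2
  simp only [avgTraction, avg, norm_smul, mul_pow]
  set A : E d := WithLp.toLp 2 ((stress γ η (w (T.plus e))).mulVec (T.normal e).ofLp)
  set B : E d := WithLp.toLp 2 ((stress γ η (w (T.minus e))).mulVec (T.normal e).ofLp)
  have h3 := parallelogram_law_with_norm ℝ A B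
  norm_num
  nlinarith [sq_nonneg ‖A - B‖]

-- Group the facets by their chosen neighbour: an element has `d + 1` vertices and each of its
-- facets is a `d`-subset of them, so it is chosen at most `d + 1` times.
open Classical in
lemma sum_adjacent_le (adj : T.IntFacet → T.Cell) (hadj : ∀ e, e.1 ⊆ (adj e).1)
    (g : T.Cell → ℝ) (hg : ∀ K, 0 ≤ g K) :
    ∑ e, g (adj e) ≤ (d + 1) * ∑ K, g K := by
  rw [← Finset.sum_fiberwise_of_maps_to (s := Finset.univ) (t := Finset.univ) (g := adj)
    (fun _ _ => Finset.mem_univ _), Finset.mul_sum]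
  refine Finset.sum_le_sum fun K _ => ?_
  have hcard : (Finset.univ.filter fun e => adj e = K).card ≤ d + 1 := by
    calc _ ≤ (K.1.powersetCard d).card := by
          refine Finset.card_le_card_of_injOn (fun e => e.1) ?_ ?_
          · intro e he
            simp only [Finset.coe_filter, Finset.mem_univ, true_and, Set.mem_ofPred_eq] at he
            exact Finset.mem_coe.mpr (Finset.mem_powersetCard.mpr ⟨he ▸ hadj e, e.2.1.2⟩)
          · intro e _ e' _ h
            exact Subtype.ext h
      _ = d + 1 := by rw [Finset.card_powersetCard, K.2.2, Nat.choose_succ_self_right]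
  calc ∑ e ∈ Finset.univ.filter (fun e => adj e = K), g (adj e)
      = ∑ e ∈ Finset.univ.filter (fun e => adj e = K), g K :=
        Finset.sum_congr rfl fun e he => by rw [(Finset.mem_filter.mp he).2]
    _ = (Finset.univ.filter fun e => adj e = K).card * g K := by simp
    _ ≤ (d + 1) * g K := mul_le_mul_of_nonneg_right (by exact_mod_cast hcard) (hg K)

/-- Threshold for the penalty parameter. -/
def penaltyThreshold (d : ℕ) (γ η κ : ℝ) : ℝ :=
  |Triangulation.facetConst d κ| * (d + 1) * stressConst d γ η / elasticLower d γ η + 1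

/-- Completing the square in the jump leaves `-(h_e/ς₁) |{σn}|²` on each facet. By `h_e |e| ≤ C |K|`
and the facet count, these losses total at most `C (d+1)/ς₁ ∑ |K| |σ_K|²`, which the elastic energy
absorbs once `ς₁` passes the threshold. -/
lemma elasticForm_self_nonneg (hd : 2 ≤ d) (hη : 0 < η) (hγ : 0 < 2 * η + d * γ) {κ : ℝ}
    (hT : T.ShapeRegular κ) {ς₁ : ℝ} (hς : penaltyThreshold d γ η κ ≤ ς₁) (w : T.P1) :
    0 ≤ elasticForm γ η ς₁ w w := by
  have hlow : 0 < elasticLower d γ η := lt_min (by positivity) hγ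
  have hst : 0 ≤ stressConst d γ η := by
    simp only [stressConst]
    positivity
  -- The absolute value covers negative `κ`, which an empty mesh allows; with the `+ 1` in the
  -- threshold it ensures `ς₁ > 0`.
  set C := |Triangulation.facetConst d κ|
  have hC0 : 0 ≤ C := abs_nonneg _
  have hς0 : 0 < ς₁ := by
    refine lt_of_lt_of_le ?_ hς
    simp only [penaltyThreshold]
    positivity
  set F : T.Cell → ℝ := fun K => frob (strain (w K)) (strain (w K))
  set S : T.Cell → ℝ := fun K => frob (stress γ η (w K)) (stress γ η (w K)) with hS
  set V : T.Cell → ℝ := fun K => volume.real K.carrier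
  have hF0 : ∀ K, 0 ≤ F K := fun K => frob_self_nonneg _
  have hS0 : ∀ K, 0 ≤ S K := fun K => frob_self_nonneg _
  have hV0 : ∀ K, 0 ≤ V K := fun K => measureReal_nonneg
  have hj : ∀ e, Continuous (jump w.eval e) := continuous_jump w.continuous_eval
  have ht : ∀ e, Continuous (avgTraction γ η w e) := continuous_avgTraction γ η w
  let A : T.IntFacet → ℝ := fun e => 2⁻¹ * (S (T.plus e) + S (T.minus e))
  -- Integrand: `(ς₁/h_e) |[w] - (h_e/ς₁){σn}|²`, with `|{σn}|²` enlarged to the constant `A e`.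
  have hsquare : 0 ≤ T.facetInt (fun e x =>
      ς₁ / e.size * ⟪jump w.eval e x, jump w.eval e x⟫_ℝ
        - 2 * ⟪avgTraction γ η w e x, jump w.eval e x⟫_ℝ + e.size / ς₁ * A e) := by
    refine facetInt_nonneg fun e x _ => ?_
    have hs := e.size_pos hd
    have h1 := norm_avgTraction_sq_le γ η w e x
    have h2 : 0 ≤ ς₁ / e.size *
        ‖jump w.eval e x - (e.size / ς₁) • avgTraction γ η w e x‖ ^ 2 := by positivity
    rw [norm_sub_sq_real, inner_smul_right, norm_smul, mul_pow, Real.norm_eq_abs, sq_abs,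
      real_inner_comm, ← real_inner_self_eq_norm_sq (jump w.eval e x)] at h2
    have h3 : ς₁ / e.size * (⟪jump w.eval e x, jump w.eval e x⟫_ℝ
        - 2 * (e.size / ς₁ * ⟪avgTraction γ η w e x, jump w.eval e x⟫_ℝ)
        + (e.size / ς₁) ^ 2 * ‖avgTraction γ η w e x‖ ^ 2) =
        ς₁ / e.size * ⟪jump w.eval e x, jump w.eval e x⟫_ℝ
        - 2 * ⟪avgTraction γ η w e x, jump w.eval e x⟫_ℝ
        + e.size / ς₁ * ‖avgTraction γ η w e x‖ ^ 2 := by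
      field_simp
    have h4 := mul_le_mul_of_nonneg_left h1 (by positivity : 0 ≤ e.size / ς₁)
    simp only [A, hS]
    linarith
  have hconst : T.facetInt (fun e _ => e.size / ς₁ * A e) ≤
      C * (d + 1) / ς₁ * ∑ K, V K * S K := by
    have hb : ∀ (e : T.IntFacet) (K : T.Cell), e.1 ⊆ K.1 →
        e.size * (μHE[d - 1] : Measure (E d)).real e.carrier ≤ C * V K := fun e K h =>
      (e.size_mul_surface_le hd hT K h).trans
        (mul_le_mul_of_nonneg_right (le_abs_self _) (hV0 K))
    have hterm : ∀ e : T.IntFacet,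
        (μHE[d - 1] : Measure (E d)).real e.carrier * (e.size / ς₁ * A e) ≤
          C / (2 * ς₁) * (V (T.plus e) * S (T.plus e) + V (T.minus e) * S (T.minus e)) := by
      intro e
      have h1 := mul_le_mul_of_nonneg_right (hb e _ (T.subset_plus e)) (hS0 (T.plus e))
      have h2 := mul_le_mul_of_nonneg_right (hb e _ (T.subset_minus e)) (hS0 (T.minus e))
      have h3 : 0 ≤ 1 / (2 * ς₁) := by positivity
      calc _ = 1 / (2 * ς₁) *
            (e.size * (μHE[d - 1] : Measure (E d)).real e.carrier * S (T.plus e)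
              + e.size * (μHE[d - 1] : Measure (E d)).real e.carrier * S (T.minus e)) := by
            simp only [A]
            field_simp
        _ ≤ 1 / (2 * ς₁) * (C * V (T.plus e) * S (T.plus e)
              + C * V (T.minus e) * S (T.minus e)) :=
            mul_le_mul_of_nonneg_left (add_le_add h1 h2) h3
        _ = _ := by ring
    have hVS : ∀ K, 0 ≤ V K * S K := fun K => mul_nonneg (hV0 K) (hS0 K)
    have hp := sum_adjacent_le T.plus T.subset_plus (fun K => V K * S K) hVS
    have hm := sum_adjacent_le T.minus T.subset_minus (fun K => V K * S K) hVS
    calc T.facetInt (fun e _ => e.size / ς₁ * A e)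
        = ∑ e : T.IntFacet,
            (μHE[d - 1] : Measure (E d)).real e.carrier * (e.size / ς₁ * A e) := by
          simp [facetInt]
      _ ≤ ∑ e, C / (2 * ς₁) *
            (V (T.plus e) * S (T.plus e) + V (T.minus e) * S (T.minus e)) :=
          Finset.sum_le_sum fun e _ => hterm e
      _ = C / (2 * ς₁) * (∑ e, V (T.plus e) * S (T.plus e)
            + ∑ e, V (T.minus e) * S (T.minus e)) := by
          rw [← Finset.mul_sum, Finset.sum_add_distrib]
      _ ≤ C / (2 * ς₁) * ((d + 1) * ∑ K, V K * S K + (d + 1) * ∑ K, V K * S K) :=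
          mul_le_mul_of_nonneg_left (add_le_add hp hm) (by positivity)
      -- The plus and minus sides each contribute `d + 1`; the factor two cancels the `1/2` of the
      -- average.
      _ = _ := by ring
  have hcell : C * (d + 1) / ς₁ * ∑ K, V K * S K ≤
      T.cellInt (fun K _ => frob (stress γ η (w K)) (strain (w K))) := by
    rw [cellInt_const, Finset.mul_sum]
    refine Finset.sum_le_sum fun K _ => ?_
    have h1 : S K ≤ stressConst d γ η * F K := frob_stress_self_le γ η hη (w K)
    have h2 := elasticLower_mul_le γ η (w K)
    have h3 : C * (d + 1) / ς₁ * stressConst d γ η ≤ elasticLower d γ η := by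
      have h4 : C * (d + 1) * stressConst d γ η / elasticLower d γ η ≤ ς₁ := by
        simp only [penaltyThreshold] at hς
        linarith
      rw [div_le_iff₀ hlow] at h4
      rw [div_mul_eq_mul_div, div_le_iff₀ hς0]
      linarith
    calc C * (d + 1) / ς₁ * (V K * S K)
        ≤ C * (d + 1) / ς₁ * (V K * (stressConst d γ η * F K)) := by
          have := hV0 K
          gcongr
      _ = V K * ((C * (d + 1) / ς₁ * stressConst d γ η) * F K) := by ring
      _ ≤ V K * (elasticLower d γ η * F K) :=
          mul_le_mul_of_nonneg_left (mul_le_mul_of_nonneg_right h3 (hF0 K)) (hV0 K)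
      _ ≤ V K * frob (stress γ η (w K)) (strain (w K)) :=
          mul_le_mul_of_nonneg_left h2 (hV0 K)
  have hi1 : FacetIntegrable (T := T) (fun e x =>
      ς₁ / e.size * ⟪jump w.eval e x, jump w.eval e x⟫_ℝ) :=
    facetIntegrable_of_continuous hd fun e => by have := hj e; fun_prop
  have hi2 : FacetIntegrable (T := T) (fun e x =>
      2 * ⟪avgTraction γ η w e x, jump w.eval e x⟫_ℝ) :=
    facetIntegrable_of_continuous hd fun e => by have := hj e; have := ht e; fun_prop
  have hi3 : FacetIntegrable (T := T) (fun e _ => e.size / ς₁ * A e) :=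
    facetIntegrable_of_continuous hd fun e => continuous_const
  have hi12 : FacetIntegrable (T := T) (fun e x =>
      ς₁ / e.size * ⟪jump w.eval e x, jump w.eval e x⟫_ℝ
        - 2 * ⟪avgTraction γ η w e x, jump w.eval e x⟫_ℝ) := fun e => (hi1 e).sub (hi2 e)
  rw [facetInt_add hi12 hi3, facetInt_sub hi1 hi2, facetInt_const_mul] at hsquare
  simp only [elasticForm]
  simp only [real_inner_comm (avgTraction γ η w _ _) (jump w.eval _ _)] at hsquare ⊢
  linarith

/-- The form decreases along `w₀ ↦ w₁` by at most twice its value at `(w₁, w₁ - w₀)`. -/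
lemma elasticForm_self_sub_le (hd : 2 ≤ d) {ς₁ : ℝ} (w₀ w₁ : T.P1)
    (h : 0 ≤ elasticForm γ η ς₁ (w₁ - w₀) (w₁ - w₀)) :
    elasticForm γ η ς₁ w₁ w₁ - elasticForm γ η ς₁ w₀ w₀ ≤
      2 * elasticForm γ η ς₁ w₁ (w₁ - w₀) := by
  rw [elasticForm_sub_right γ η hd, elasticForm_comm γ η ς₁ (w₁ - w₀) w₁,
    elasticForm_comm γ η ς₁ (w₁ - w₀) w₀, elasticForm_sub_right γ η hd,
    elasticForm_sub_right γ η hd, elasticForm_comm γ η ς₁ w₀ w₁] at h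
  rw [elasticForm_sub_right γ η hd]
  linarith

end Form

end Mesh

/-! ### Quadratic Taylor bound and the Peng–Robinson free energy. -/

/-- A `C²` function on an open set deviates from its tangent plane by at most a fixed multiple of
the squared distance, uniformly on a compact convex subset. -/
lemma exists_sub_fderiv_le {V : Type*} [NormedAddCommGroup V] [NormedSpace ℝ V] {f : V → ℝ}
    {s : Set V} (hf : ∀ x ∈ s, ContDiffAt ℝ 2 f x) (hs : IsCompact s) (hc : Convex ℝ s) :
    ∃ L : ℝ, ∀ x ∈ s, ∀ y ∈ s, f x - f y - fderiv ℝ f y (x - y) ≤ L * ‖x - y‖ ^ 2 := by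
  have hf' : ∀ x ∈ s, ContDiffAt ℝ 1 (fderiv ℝ f) x := fun x hx =>
    (hf x hx).fderiv_right (m := 1) (by norm_num)
  have hcont : ContinuousOn (fderiv ℝ (fderiv ℝ f)) s := fun x hx =>
    ((hf' x hx).fderiv_right (m := 0) (by norm_num)).continuousAt.continuousWithinAt
  obtain ⟨L, hL⟩ := hs.exists_bound_of_continuousOn (E := V →L[ℝ] V →L[ℝ] ℝ) hcont
  refine ⟨L, fun x hx y hy => ?_⟩
  have hL0 : 0 ≤ L := (norm_nonneg _).trans (hL x hx)
  have hlip : ∀ z ∈ s, ‖fderiv ℝ f z - fderiv ℝ f y‖ ≤ L * ‖z - y‖ := fun z hz =>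
    hc.norm_image_sub_le_of_norm_fderiv_le
      (fun u hu => (hf' u hu).differentiableAt one_ne_zero) hL hy hz
  have hseg : segment ℝ y x ⊆ s := hc.segment_subset hy hx
  -- Mean value inequality for `f` minus its linearization at `y`, whose derivative is at most `L ‖x
  -- - y‖` along the segment. The sharp factor `1/2` is not needed.
  have hmv := (convex_segment y x).norm_image_sub_le_of_norm_hasFDerivWithin_le
    (f := fun z => f z - fderiv ℝ f y z) (f' := fun z => fderiv ℝ f z - fderiv ℝ f y)
    (C := L * ‖x - y‖)
    (fun z hz => ((((hf z (hseg hz)).differentiableAt two_ne_zero).hasFDerivAt).sub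
      (fderiv ℝ f y).hasFDerivAt).hasFDerivWithinAt)
    (fun z hz => (hlip z (hseg hz)).trans
      (mul_le_mul_of_nonneg_left (norm_sub_le_of_mem_segment hz) hL0))
    (left_mem_segment ℝ y x) (right_mem_segment ℝ y x)
  calc f x - f y - fderiv ℝ f y (x - y)
      = (f x - fderiv ℝ f y x) - (f y - fderiv ℝ f y y) := by rw [map_sub]; ring
    _ ≤ ‖(f x - fderiv ℝ f y x) - (f y - fderiv ℝ f y y)‖ := Real.le_norm_self _
    _ ≤ L * ‖x - y‖ * ‖x - y‖ := hmv
    _ = L * ‖x - y‖ ^ 2 := by ring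

namespace Mixture

variable {M : ℕ} (F : Mixture M)

lemma betaPure_pos (i : Fin (M + 1)) : 0 < F.betaPure i := by
  have := F.R_pos
  have := F.Tc_pos i
  have := F.Pc_pos i
  simp only [betaPure]
  positivity

lemma betaPure_le_betaStar (i : Fin (M + 1)) : F.betaPure i ≤ F.betaStar :=
  Finset.le_sup' F.betaPure (Finset.mem_univ i)

lemma betaStar_pos : 0 < F.betaStar := (F.betaPure_pos 0).trans_le (F.betaPure_le_betaStar 0)

lemma total_pos {c : Fin (M + 1) → ℝ} (hc : ∀ i, 0 < c i) : 0 < total c :=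
  Finset.sum_pos (fun i _ => hc i) Finset.univ_nonempty

lemma betaMix_pos {c : Fin (M + 1) → ℝ} (hc : ∀ i, 0 < c i) : 0 < F.betaMix c :=
  Finset.sum_pos (fun i _ => mul_pos (div_pos (hc i) (total_pos hc)) (F.betaPure_pos i))
    Finset.univ_nonempty

lemma betaMix_le {c : Fin (M + 1) → ℝ} (hc : ∀ i, 0 < c i) : F.betaMix c ≤ F.betaStar := by
  have ht := total_pos hc
  calc F.betaMix c ≤ ∑ i, c i / total c * F.betaStar :=
        Finset.sum_le_sum fun i _ => mul_le_mul_of_nonneg_left (F.betaPure_le_betaStar i)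
          (div_pos (hc i) ht).le
    _ = F.betaStar := by
      rw [← Finset.sum_mul, ← Finset.sum_div]
      change total c / total c * F.betaStar = F.betaStar
      rw [div_self ht.ne', one_mul]

lemma contDiff_total : ContDiff ℝ 2 (total (M := M)) :=
  ContDiff.sum fun i _ => contDiff_apply ℝ ℝ i

/-- All denominators and logarithm arguments stay positive: `β ≤ β*` gives `0 < βc < 1`, and then
`(√2 - 1)βc < 1`. -/
lemma contDiffAt_freeEnergy {c : Fin (M + 1) → ℝ} (hc : ∀ i, 0 < c i)
    (hb : F.betaStar * total c < 1) : ContDiffAt ℝ 2 F.freeEnergy c := by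
  have ht := total_pos hc
  have hβ := F.betaMix_pos hc
  have hlt : F.betaMix c * total c < 1 :=
    (mul_le_mul_of_nonneg_right (F.betaMix_le hc) ht.le).trans_lt hb
  have hpos : 0 < F.betaMix c * total c := mul_pos hβ ht
  have hcoord : ∀ i, ContDiffAt ℝ 2 (fun c : Fin (M + 1) → ℝ => c i) c := fun i =>
    (contDiff_apply ℝ ℝ i).contDiffAt
  have htot : ContDiffAt ℝ 2 (total (M := M)) c := contDiff_total.contDiffAt
  have hmix : ContDiffAt ℝ 2 F.betaMix c :=
    ContDiffAt.sum fun i _ => ((hcoord i).div htot ht.ne').mul contDiffAt_const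
  have hα : ContDiffAt ℝ 2 F.alphaMix c :=
    ContDiffAt.sum fun i _ => ContDiffAt.sum fun j _ =>
      ((((hcoord i).mul (hcoord j)).div (htot.pow 2) (pow_ne_zero 2 ht.ne')).mul
        contDiffAt_const).mul contDiffAt_const
  have hsq : Real.sqrt 2 < 2 := by
    rw [Real.sqrt_lt' two_pos]
    norm_num
  have hsq0 : 0 < Real.sqrt 2 := Real.sqrt_pos.mpr two_pos
  have hnum : 0 < 1 + (1 - Real.sqrt 2) * F.betaMix c * total c := by
    rw [mul_assoc]
    nlinarith
  have hden : 0 < 1 + (1 + Real.sqrt 2) * F.betaMix c * total c := by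
    rw [mul_assoc]
    nlinarith
  have hlin : ∀ k : ℝ, ContDiffAt ℝ 2 (fun c => 1 + k * F.betaMix c * total c) c := fun k =>
    contDiffAt_const.add ((contDiffAt_const.mul hmix).mul htot)
  have h1 : ContDiffAt ℝ 2
      (fun c : Fin (M + 1) → ℝ => F.R * F.temp * ∑ i, c i * (Real.log (c i) - 1)) c :=
    contDiffAt_const.mul (ContDiffAt.sum fun i _ =>
      (hcoord i).mul (((hcoord i).log (hc i).ne').sub contDiffAt_const))
  have h2 : ContDiffAt ℝ 2 (fun c => total c * F.R * F.temp *
      Real.log (1 - F.betaMix c * total c)) c :=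
    ((htot.mul contDiffAt_const).mul contDiffAt_const).mul
      ((contDiffAt_const.sub (hmix.mul htot)).log (sub_pos.mpr hlt).ne')
  have h3 : ContDiffAt ℝ 2 (fun c => F.alphaMix c * total c / (2 * Real.sqrt 2 * F.betaMix c) *
      Real.log ((1 + (1 - Real.sqrt 2) * F.betaMix c * total c) /
        (1 + (1 + Real.sqrt 2) * F.betaMix c * total c))) c :=
    ((hα.mul htot).div (contDiffAt_const.mul hmix) (by positivity)).mul
      (((hlin _).div (hlin _) hden.ne').log (div_pos hnum hden).ne')
  exact (h1.sub h2).add h3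

lemma chemPot_eq {c : Fin (M + 1) → ℝ} (hf : DifferentiableAt ℝ F.freeEnergy c)
    (i : Fin (M + 1)) : F.chemPot i c = fderiv ℝ F.freeEnergy c (Pi.single i 1) := by
  have h1 : HasFDerivAt F.freeEnergy (fderiv ℝ F.freeEnergy c) (Function.update c i (c i)) := by
    rw [Function.update_eq_self]
    exact hf.hasFDerivAt
  exact (h1.comp_hasDerivAt (c i) (hasDerivAt_update c i (c i))).deriv

/-- Admissible densities: `c_i ≥ m` and `β* c ≤ ϱ`. -/
def admissible (m ϱ : ℝ) : Set (Fin (M + 1) → ℝ) :=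
  {c | (∀ i, m ≤ c i) ∧ F.betaStar * total c ≤ ϱ}

lemma convex_admissible (m ϱ : ℝ) : Convex ℝ (F.admissible m ϱ) := by
  intro x hx y hy a b ha hb hab
  refine ⟨fun i => ?_, ?_⟩
  · calc m = a * m + b * m := by rw [← add_mul, hab, one_mul]
      _ ≤ a * x i + b * y i := add_le_add (mul_le_mul_of_nonneg_left (hx.1 i) ha)
          (mul_le_mul_of_nonneg_left (hy.1 i) hb)
  · have h : F.betaStar * total (a • x + b • y) =
        a * (F.betaStar * total x) + b * (F.betaStar * total y) := by
      simp only [total, Pi.add_apply, Pi.smul_apply, smul_eq_mul, Finset.sum_add_distrib,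
        ← Finset.mul_sum]
      ring
    calc _ = _ := h
      _ ≤ a * ϱ + b * ϱ := add_le_add (mul_le_mul_of_nonneg_left hx.2 ha)
          (mul_le_mul_of_nonneg_left hy.2 hb)
      _ = ϱ := by rw [← add_mul, hab, one_mul]

/-- Positivity of the components bounds each by the total, so the set lies in the box `[m,
ϱ/β*]^(M+1)`. -/
lemma isCompact_admissible {m : ℝ} (hm : 0 < m) (ϱ : ℝ) : IsCompact (F.admissible m ϱ) := by
  have hclosed : IsClosed (F.admissible m ϱ) := by
    have h : F.admissible m ϱ = Set.Ici (fun _ => m) ∩ {c | F.betaStar * total c ≤ ϱ} := by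
      ext c
      simp [admissible, Pi.le_def]
    rw [h]
    exact isClosed_Ici.inter
      (isClosed_le (continuous_const.mul contDiff_total.continuous) continuous_const)
  refine (isCompact_univ_pi fun _ => isCompact_Icc (a := m) (b := ϱ / F.betaStar)).of_isClosed_subset
    hclosed fun c hc i _ => ⟨hc.1 i, ?_⟩
  rw [le_div_iff₀ F.betaStar_pos, mul_comm]
  refine le_trans (mul_le_mul_of_nonneg_left ?_ F.betaStar_pos.le) hc.2
  exact Finset.single_le_sum (fun j _ => hm.le.trans (hc.1 j)) (Finset.mem_univ i)

/-- For a sufficiently large stabilization parameter, the increment of the free energy is bounded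
by the stabilized chemical potentials. -/
lemma exists_stabilization {m ϱ : ℝ} (hm : 0 < m) (hϱ : ϱ < 1) :
    ∃ θstar : ℝ, ∀ θ, θstar ≤ θ → ∀ c₁ ∈ F.admissible m ϱ, ∀ c₀ ∈ F.admissible m ϱ,
      F.freeEnergy c₁ - F.freeEnergy c₀ ≤ ∑ i, (c₁ i - c₀ i) *
        (F.chemPot i c₀ + θ * F.R * F.temp *
          ((c₁ i - c₀ i) / (total c₀ * (1 - F.betaStar * total c₀)))) := by
  have hsmooth : ∀ c ∈ F.admissible m ϱ, ContDiffAt ℝ 2 F.freeEnergy c := fun c hc =>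
    F.contDiffAt_freeEnergy (fun i => hm.trans_le (hc.1 i)) (hc.2.trans_lt hϱ)
  obtain ⟨L, hL⟩ := exists_sub_fderiv_le hsmooth (F.isCompact_admissible hm ϱ)
    (F.convex_admissible m ϱ)
  have hβ := F.betaStar_pos
  have hRT : 0 < F.R * F.temp := mul_pos F.R_pos F.temp_pos
  -- Since `β* c (1 - β* c) ≤ 1`, the stabilization coefficient is at least `θ R T β*`; this choice
  -- makes it at least `|L|`.
  refine ⟨|L| / (F.R * F.temp * F.betaStar), fun θ hθ c₁ h₁ c₀ h₀ => ?_⟩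
  have ht : 0 < total c₀ := total_pos fun i => hm.trans_le (h₀.1 i)
  have hgap : 0 < 1 - F.betaStar * total c₀ := by linarith [h₀.2]
  have hden : 0 < total c₀ * (1 - F.betaStar * total c₀) := mul_pos ht hgap
  have hθL : |L| ≤ θ * (F.R * F.temp * F.betaStar) := by
    rwa [div_le_iff₀ (mul_pos hRT hβ)] at hθ
  have hθ0 : 0 ≤ θ := (by positivity : 0 ≤ |L| / (F.R * F.temp * F.betaStar)).trans hθ
  have hcoef : |L| ≤ θ * F.R * F.temp / (total c₀ * (1 - F.betaStar * total c₀)) := by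
    rw [le_div_iff₀ hden]
    have h1 : F.betaStar * (total c₀ * (1 - F.betaStar * total c₀)) ≤ 1 := by
      nlinarith [mul_pos hβ ht]
    calc |L| * (total c₀ * (1 - F.betaStar * total c₀))
        ≤ θ * (F.R * F.temp * F.betaStar) * (total c₀ * (1 - F.betaStar * total c₀)) :=
          mul_le_mul_of_nonneg_right hθL hden.le
      _ = θ * (F.R * F.temp) *
            (F.betaStar * (total c₀ * (1 - F.betaStar * total c₀))) := by ring
      _ ≤ θ * (F.R * F.temp) * 1 := mul_le_mul_of_nonneg_left h1 (by positivity)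
      _ = θ * F.R * F.temp := by ring
  -- The norm on the function space is the supremum norm, so it is dominated by the Euclidean one.
  have hnorm : ‖c₁ - c₀‖ ^ 2 ≤ ∑ i, (c₁ i - c₀ i) ^ 2 := by
    have h0 : 0 ≤ ∑ i, (c₁ i - c₀ i) ^ 2 := Finset.sum_nonneg fun _ _ => sq_nonneg _
    have : ‖c₁ - c₀‖ ≤ Real.sqrt (∑ i, (c₁ i - c₀ i) ^ 2) := by
      refine (pi_norm_le_iff_of_nonneg (Real.sqrt_nonneg _)).mpr fun i => ?_
      refine Real.abs_le_sqrt ?_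
      exact Finset.single_le_sum (f := fun i => (c₁ i - c₀ i) ^ 2) (fun _ _ => sq_nonneg _)
        (Finset.mem_univ i)
    calc _ ≤ Real.sqrt (∑ i, (c₁ i - c₀ i) ^ 2) ^ 2 := pow_le_pow_left₀ (norm_nonneg _) this 2
      _ = _ := Real.sq_sqrt h0
  have hlinear : fderiv ℝ F.freeEnergy c₀ (c₁ - c₀) =
      ∑ i, (c₁ i - c₀ i) * F.chemPot i c₀ := by
    conv_lhs => rw [pi_eq_sum_univ' (c₁ - c₀)]
    rw [map_sum]
    refine Finset.sum_congr rfl fun i _ => ?_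
    rw [F.chemPot_eq ((hsmooth c₀ h₀).differentiableAt two_ne_zero), map_smul, smul_eq_mul,
      Pi.sub_apply]
  calc F.freeEnergy c₁ - F.freeEnergy c₀
      ≤ ∑ i, (c₁ i - c₀ i) * F.chemPot i c₀ + L * ‖c₁ - c₀‖ ^ 2 := by
        have := hL c₁ h₁ c₀ h₀
        linarith
    _ ≤ ∑ i, (c₁ i - c₀ i) * F.chemPot i c₀ +
          θ * F.R * F.temp / (total c₀ * (1 - F.betaStar * total c₀)) *
            ∑ i, (c₁ i - c₀ i) ^ 2 := by
        refine add_le_add_right (mul_le_mul ((le_abs_self L).trans hcoef) hnorm (sq_nonneg _)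
          ((abs_nonneg L).trans hcoef)) _
    _ = _ := by
        rw [Finset.mul_sum, ← Finset.sum_add_distrib]
        refine Finset.sum_congr rfl fun i _ => ?_
        ring

end Mixture

/-! ### Signs of the transport coefficients. -/

namespace Transport

variable {d M : ℕ} {T : Mesh d} (P : Transport T M)

lemma permFacet_nonneg (e : T.IntFacet) : 0 ≤ P.permFacet e := by
  simp only [permFacet, average_eq]
  refine smul_nonneg (inv_nonneg.mpr measureReal_nonneg)
    (setIntegral_nonneg e.isCompact_carrier.measurableSet fun x hx => ?_)
  have h1 := P.perm_pos _ x (e.carrier_subset _ (T.subset_plus e) hx)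
  have h2 := P.perm_pos _ x (e.carrier_subset _ (T.subset_minus e) hx)
  simp only [Mesh.avg, smul_eq_mul]
  positivity

lemma scaledDs_pos (i : Fin (M + 1)) (K : T.Cell) {x : E d} (hx : x ∈ K.carrier) :
    0 < P.scaledDs i K x := by
  have h1 := sub_pos.mpr P.φr_lt_one
  have h2 := sub_pos.mpr (P.φhat_lt_one K)
  have h3 := P.φr_pos
  have h4 := P.φhat_pos K
  have h5 := P.visc_pos i
  have h6 := P.perm_pos K x hx
  simp only [scaledDs, kozenyCarman]
  positivity

end Transport

/-! ### Mass balances, dissipation and the energy law. -/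

namespace State

open Mesh

variable {d M : ℕ} {T : Mesh d}

lemma dens_castSucc (X : State T M) (K : T.Cell) (i : Fin M) :
    X.dens K i.castSucc = X.ci i K := by
  simp [dens]

lemma sum_dens (X : State T M) (K : T.Cell) : ∑ i, X.dens K i = X.c K := by
  simp [dens, Fin.sum_univ_castSucc]

lemma total_dens (X : State T M) (K : T.Cell) : Mixture.total (X.dens K) = X.c K :=
  X.sum_dens K

lemma Bounded.mem_admissible {F : Mixture M} {m ϱ : ℝ} {X : State T M} (h : X.Bounded F m ϱ)
    (K : T.Cell) : X.dens K ∈ F.admissible m ϱ :=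
  ⟨(h K).2.1, by rw [total_dens]; exact (h K).2.2⟩

lemma chemTotal_eq (F : Mixture M) (θ : ℝ) (X₀ X₁ : State T M) (K : T.Cell) :
    chemTotal F θ X₀ X₁ K = ∑ i, chem F θ X₀ X₁ i K := by
  simp only [chemTotal, chem, Finset.sum_add_distrib, ← Finset.mul_sum, ← Finset.sum_div,
    Finset.sum_sub_distrib, sum_dens]

lemma continuous_eval (v : T.BrokenRT0) (K : T.Cell) : Continuous (v.eval K) := by
  change Continuous fun x => (v K).1 + (v K).2 • x
  fun_prop

lemma continuous_flux (v : T.BrokenRT0) (e : T.IntFacet) : Continuous (flux v e) :=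
  (continuous_eval v _).inner continuous_const

/-- The upwind value may jump along a facet, so continuity is unavailable; it is measurable with
only two values. -/
lemma facetIntegrable_upwind_mul (hd : 2 ≤ d) (X : State T M) (i : Fin (M + 1))
    {g : T.IntFacet → E d → ℝ} (hg : ∀ e, Continuous (g e)) :
    FacetIntegrable (T := T) (fun e x => X.upwind i e x * g e x) := by
  intro e
  have hmeas : Measurable (X.upwind i e) :=
    Measurable.ite (measurableSet_le measurable_const (continuous_flux (X.u i) e).measurable)
      measurable_const measurable_const
  refine Integrable.mono' (((e.integrableOn_of_continuous hd (hg e)).norm).const_mul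
    (|X.comp i (T.plus e)| + |X.comp i (T.minus e)|))
    (hmeas.mul (hg e).measurable).aestronglyMeasurable (.of_forall fun x => ?_)
  rw [norm_mul]
  refine mul_le_mul_of_nonneg_right ?_ (norm_nonneg _)
  simp only [upwind, Real.norm_eq_abs]
  split_ifs
  · exact le_add_of_nonneg_right (abs_nonneg _)
  · exact le_add_of_nonneg_left (abs_nonneg _)

lemma continuous_jump_eval (q : T.P0) (e : T.IntFacet) : Continuous (jump q.eval e) :=
  continuous_jump (fun _ => continuous_const) e

variable {F : Mixture M} {P : Transport T M} {γ η a N ς ς₁ τ θ : ℝ} {X₀ X₁ : State T M}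

/-- Accumulation, transport and penalty terms of the mass balance of one component. -/
def massBalance (F : Mixture M) (P : Transport T M) (ς τ θ : ℝ) (X₀ X₁ : State T M)
    (i : Fin (M + 1)) (q : T.P0) : ℝ :=
  T.cellInt (fun K _ => Dτ τ (X₁.φ K * X₁.dens K i) (X₀.φ K * X₀.dens K i) * q K)
    + T.facetInt (fun e x => X₀.upwind i e x * flux (X₁.u i) e x * jump q.eval e x)
    + T.facetInt (fun e x => ς / e.size *
        (P.permFacet e * jump (chem F θ X₀ X₁ i).eval e x * jump q.eval e x))

lemma IsStep.sum_massBalance (hd : 2 ≤ d) (h : IsStep F P γ η a N ς ς₁ τ θ X₀ X₁)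
    (q : T.P0) : ∑ i, massBalance F P ς τ θ X₀ X₁ i q = 0 := by
  rw [← h.mass_total q]
  simp only [massBalance, Finset.sum_add_distrib]
  rw [← facetInt_sum, ← facetInt_sum]
  · congr 1
    · congr 1
      · simp only [cellInt_const, Dτ, smul_eq_mul]
        rw [Finset.sum_comm]
        refine Finset.sum_congr rfl fun K _ => ?_
        rw [← Finset.mul_sum, ← Finset.sum_mul, ← Finset.mul_sum, Finset.sum_sub_distrib,
          ← Finset.mul_sum, ← Finset.mul_sum, sum_dens, sum_dens]
      · simp only [Finset.sum_mul]
    · congr 1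
      funext e x
      simp only [jump, P0.eval, chemTotal_eq, ← Finset.mul_sum, ← Finset.sum_mul,
        Finset.sum_sub_distrib]
  · exact fun i => facetIntegrable_of_continuous hd fun e =>
      continuous_const.mul ((continuous_const.mul (continuous_jump_eval _ e)).mul
        (continuous_jump_eval q e))
  · intro i
    simp only [mul_assoc]
    exact facetIntegrable_upwind_mul hd X₀ i fun e =>
      (continuous_flux (X₁.u i) e).mul (continuous_jump_eval q e)

/-- The last component has no equation of its own: its balance is the total one minus the others,
since densities and stabilized potentials both sum to their totals. -/
lemma IsStep.massBalance_eq_zero (hd : 2 ≤ d) (h : IsStep F P γ η a N ς ς₁ τ θ X₀ X₁)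
    (i : Fin (M + 1)) (q : T.P0) : massBalance F P ς τ θ X₀ X₁ i q = 0 := by
  have hc : ∀ i : Fin M, massBalance F P ς τ θ X₀ X₁ i.castSucc q = 0 := fun i => by
    simpa only [massBalance, dens_castSucc] using h.mass_comp i q
  induction i using Fin.lastCases with
  | last =>
    have hs := h.sum_massBalance hd q
    rwa [Fin.sum_univ_castSucc, Finset.sum_eq_zero fun i _ => hc i, zero_add] at hs
  | cast i => exact hc i

/-- The Maxwell–Stefan–Darcy dissipation is nonnegative. -/
lemma IsStep.sum_upwind_nonneg (h : IsStep F P γ η a N ς ς₁ τ θ X₀ X₁)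
    (hpos : ∀ K i, 0 < X₀.dens K i) :
    0 ≤ ∑ i, T.facetInt (fun e x => X₀.upwind i e x * flux (X₁.u i) e x *
      jump (chem F θ X₀ X₁ i).eval e x) := by
  let k : Fin (M + 1) → Fin (M + 1) → T.Cell → ℝ := fun i j K =>
    X₀.dens K i * X₀.dens K j / (X₀.c K ^ 2 * P.scaledD i j K)
  let I : Fin (M + 1) → Fin (M + 1) → ℝ := fun i j => T.cellInt fun K x =>
    k i j K * ⟪(X₁.u i).eval K x - (X₁.u j).eval K x, (X₁.u i).eval K x⟫_ℝ
  have hksymm : ∀ i j K, k i j K = k j i K := fun i j K => by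
    simp only [k, Transport.scaledD, P.D_symm i j, mul_comm (X₀.dens K i)]
  have hint : ∀ i j, CellIntegrable (T := T) fun K x =>
      k i j K * ⟪(X₁.u i).eval K x - (X₁.u j).eval K x, (X₁.u i).eval K x⟫_ℝ := fun i j =>
    cellIntegrable_of_continuousOn fun K => Continuous.continuousOn <| by
      have := continuous_eval (X₁.u i) K
      have := continuous_eval (X₁.u j) K
      fun_prop
  -- By symmetry of the friction coefficients, the `(i, j)` and `(j, i)` terms combine into a
  -- multiple of `|u_i - u_j|²`.
  have hpair : ∀ i j, 0 ≤ I i j + I j i := fun i j => by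
    rcases eq_or_ne i j with rfl | hij
    · simp [I, cellInt]
    rw [← cellInt_add (hint i j) (hint j i)]
    refine cellInt_nonneg fun K x _ => ?_
    have hk : 0 ≤ k i j K := by
      have h1 := hpos K i
      have h2 := hpos K j
      have h3 := P.φhat_pos K
      have h4 := P.D_pos i j hij
      simp only [k, Transport.scaledD]
      positivity
    have heq : k i j K * ⟪(X₁.u i).eval K x - (X₁.u j).eval K x, (X₁.u i).eval K x⟫_ℝ
        + k j i K * ⟪(X₁.u j).eval K x - (X₁.u i).eval K x, (X₁.u j).eval K x⟫_ℝ
        = k i j K * ⟪(X₁.u i).eval K x - (X₁.u j).eval K x,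
            (X₁.u i).eval K x - (X₁.u j).eval K x⟫_ℝ := by
      rw [hksymm j i, inner_sub_right, ← neg_sub ((X₁.u i).eval K x), inner_neg_left]
      ring
    rw [heq]
    exact mul_nonneg hk real_inner_self_nonneg
  have hdouble : 0 ≤ ∑ i, ∑ j, I i j := by
    have h1 : 0 ≤ ∑ i, ∑ j, (I i j + I j i) :=
      Finset.sum_nonneg fun i _ => Finset.sum_nonneg fun j _ => hpair i j
    simp only [Finset.sum_add_distrib] at h1
    rw [Finset.sum_comm (f := fun i j => I j i)] at h1
    linarith
  have hfacet : ∀ i, T.facetInt (fun e x => X₀.upwind i e x * flux (X₁.u i) e x *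
      jump (chem F θ X₀ X₁ i).eval e x) = ∑ j, I i j +
        T.cellInt (fun K x => 1 / P.scaledDs i K x *
          ⟪(X₁.u i).eval K x, (X₁.u i).eval K x⟫_ℝ) := fun i => by
    have hi : I i i = 0 := by simp [I, cellInt]
    rw [← Finset.sum_erase Finset.univ hi, h.maxwell_stefan i (X₁.u i) (X₁.u_mem i)]
    simp only [mul_comm (jump _ _ _)]
  simp only [hfacet, Finset.sum_add_distrib]
  refine add_nonneg hdouble (Finset.sum_nonneg fun i _ => cellInt_nonneg fun K x hx => ?_)
  exact mul_nonneg (one_div_pos.mpr (P.scaledDs_pos i K hx)).le real_inner_self_nonneg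

/-- Testing the mass balances with the chemical potentials gives dissipation. -/
lemma IsStep.sum_chem_nonpos (hd : 2 ≤ d) (h : IsStep F P γ η a N ς ς₁ τ θ X₀ X₁)
    (hς : 0 ≤ ς) (hpos : ∀ K i, 0 < X₀.dens K i) :
    ∑ i, T.cellInt (fun K _ => Dτ τ (X₁.φ K * X₁.dens K i) (X₀.φ K * X₀.dens K i) *
      chem F θ X₀ X₁ i K) ≤ 0 := by
  have hsum : ∑ i, massBalance F P ς τ θ X₀ X₁ i (chem F θ X₀ X₁ i) = 0 :=
    Finset.sum_eq_zero fun i _ => h.massBalance_eq_zero hd i _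
  have hdiss := h.sum_upwind_nonneg hpos
  have hpen : 0 ≤ ∑ i, T.facetInt (fun e x => ς / e.size *
      (P.permFacet e * jump (chem F θ X₀ X₁ i).eval e x *
        jump (chem F θ X₀ X₁ i).eval e x)) :=
    Finset.sum_nonneg fun i _ => facetInt_nonneg fun e x _ => by
      rw [mul_assoc (P.permFacet e)]
      exact mul_nonneg (div_nonneg hς e.size_nonneg)
        (mul_nonneg (P.permFacet_nonneg e) (mul_self_nonneg _))
  simp only [massBalance, Finset.sum_add_distrib] at hsum
  linarith

/-- The single traction term of the energy is half of the two consistency terms of `elasticForm`,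
which coincide on the diagonal. -/
lemma energy_eq (X : State T M) :
    X.energy F γ η N ς₁ = ∑ K, volume.real K.carrier * (X.φ K * F.freeEnergy (X.dens K))
      + 1 / 2 * elasticForm γ η ς₁ X.w X.w
      + 1 / (2 * N) * ∑ K, volume.real K.carrier * X.p K ^ 2 := by
  have h1 : T.facetInt (fun e x => ς₁ / (2 * e.size) *
      ⟪jump X.w.eval e x, jump X.w.eval e x⟫_ℝ) = 1 / 2 * T.facetInt (fun e x =>
        ς₁ / e.size * ⟪jump X.w.eval e x, jump X.w.eval e x⟫_ℝ) := by
    rw [← facetInt_const_mul]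
    congr 1
    funext e x
    rw [mul_comm 2 e.size, ← div_div]
    ring
  have h2 : T.cellInt (fun K _ => X.φ K * F.freeEnergy (X.dens K)
      + 1 / 2 * frob (stress γ η (X.w K)) (strain (X.w K)) + 1 / (2 * N) * |X.p K| ^ 2) =
      ∑ K, volume.real K.carrier * (X.φ K * F.freeEnergy (X.dens K))
      + 1 / 2 * T.cellInt (fun K _ => frob (stress γ η (X.w K)) (strain (X.w K)))
      + 1 / (2 * N) * ∑ K, volume.real K.carrier * X.p K ^ 2 := by
    simp only [cellInt_const, Finset.mul_sum, ← Finset.sum_add_distrib, sq_abs]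
    exact Finset.sum_congr rfl fun K _ => by ring
  simp only [energy, elasticForm]
  rw [h1, h2]
  simp only [real_inner_comm (avgTraction γ η X.w _ _) (jump X.w.eval _ _)]
  ring

/-- The stabilized scheme dissipates the energy, given coercivity of the elastic form and the
stabilization property of the chemical potentials. -/
theorem IsStep.energy_le (hd : 2 ≤ d) (h : IsStep F P γ η a N ς ς₁ τ θ X₀ X₁) (hN : 0 < N)
    (hς : 0 ≤ ς) (hτ : 0 < τ) (hpos : ∀ K i, 0 < X₀.dens K i) (hφ : ∀ K, 0 < X₁.φ K)
    (hel : 0 ≤ elasticForm γ η ς₁ (X₁.w - X₀.w) (X₁.w - X₀.w))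
    (hstab : ∀ K, F.freeEnergy (X₁.dens K) - F.freeEnergy (X₀.dens K) ≤
      ∑ i, (X₁.dens K i - X₀.dens K i) * chem F θ X₀ X₁ i K) :
    Dτ τ (X₁.energy F γ η N ς₁) (X₀.energy F γ η N ς₁) ≤ 0 := by
  have hτ' : 0 < τ⁻¹ := inv_pos.mpr hτ
  have hmom : elasticForm γ η ς₁ X₁.w (Dτ τ X₁.w X₀.w) =
      a * pressureForm X₁.p (Dτ τ X₁.w X₀.w) := by
    have := h.momentum (Dτ τ X₁.w X₀.w)
    rw [formA_eq] at this
    linarith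
  have hpor := h.porosity X₁.p
  have hdvg : T.cellInt (fun K _ => Dτ τ (dvg (X₁.w K)) (dvg (X₀.w K)) * X₁.p K) =
      T.cellInt (fun K _ => X₁.p K * dvg (Dτ τ X₁.w X₀.w K)) := by
    simp only [Dτ, Pi.smul_apply, Pi.sub_apply, dvg_smul, dvg_sub, smul_eq_mul, mul_comm]
  have hpress := h.pressure (fun K => Dτ τ (X₁.φ K) (X₀.φ K))
  have hchem := h.sum_chem_nonpos hd hς hpos
  have helastic := elasticForm_self_sub_le γ η hd X₀.w X₁.w hel
  rw [hdvg] at hpor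
  simp only [pressureForm] at hmom
  rw [Dτ, elasticForm_smul_right] at hmom
  simp only [cellInt_const] at hmom hpor hpress hchem
  rw [Finset.sum_comm] at hchem
  simp only [Dτ, smul_eq_mul] at hmom hpor hpress hchem ⊢
  -- Uses `φ₁c₁ - φ₀c₀ = φ₁(c₁ - c₀) + (φ₁ - φ₀)c₀` and the same splitting of `φf`; positivity of
  -- `φ₁` lets the stabilization bound be multiplied through.
  have hcell : ∀ K : T.Cell,
      τ⁻¹ * (volume.real K.carrier * (X₁.φ K * F.freeEnergy (X₁.dens K)))
        - τ⁻¹ * (volume.real K.carrier * (X₀.φ K * F.freeEnergy (X₀.dens K)))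
        + volume.real K.carrier * ((∑ i, X₀.dens K i * chem F θ X₀ X₁ i K
            - F.freeEnergy (X₀.dens K)) * (τ⁻¹ * (X₁.φ K - X₀.φ K))) ≤
      ∑ i, volume.real K.carrier * (τ⁻¹ * (X₁.φ K * X₁.dens K i - X₀.φ K * X₀.dens K i) *
        chem F θ X₀ X₁ i K) := by
    intro K
    have hs : ∑ i, volume.real K.carrier *
        (τ⁻¹ * (X₁.φ K * X₁.dens K i - X₀.φ K * X₀.dens K i) * chem F θ X₀ X₁ i K) =
        volume.real K.carrier * τ⁻¹ *
          (X₁.φ K * ∑ i, (X₁.dens K i - X₀.dens K i) * chem F θ X₀ X₁ i K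
            + (X₁.φ K - X₀.φ K) * ∑ i, X₀.dens K i * chem F θ X₀ X₁ i K) := by
      rw [Finset.mul_sum, Finset.mul_sum, ← Finset.sum_add_distrib, Finset.mul_sum]
      exact Finset.sum_congr rfl fun i _ => by ring
    have hk : 0 ≤ volume.real K.carrier * τ⁻¹ * X₁.φ K :=
      mul_nonneg (mul_nonneg measureReal_nonneg hτ'.le) (hφ K).le
    have := mul_le_mul_of_nonneg_left (hstab K) hk
    rw [hs]
    linarith
  have hcells := Finset.sum_le_sum fun K (_ : K ∈ (Finset.univ : Finset T.Cell)) => hcell K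
  simp only [Finset.sum_add_distrib, Finset.sum_sub_distrib, ← Finset.mul_sum] at hcells
  -- The defect is the square of the pressure increment.
  have hp : 1 / (2 * N) * (∑ K, volume.real K.carrier * X₁.p K ^ 2
      - ∑ K, volume.real K.carrier * X₀.p K ^ 2) * τ⁻¹ ≤
      1 / N * ∑ K, volume.real K.carrier * (τ⁻¹ * (X₁.p K - X₀.p K) * X₁.p K) := by
    rw [← Finset.sum_sub_distrib, Finset.mul_sum, Finset.sum_mul, Finset.mul_sum]
    refine Finset.sum_le_sum fun K _ => ?_
    have hk : 0 ≤ 1 / (2 * N) * volume.real K.carrier * τ⁻¹ * (X₁.p K - X₀.p K) ^ 2 := by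
      have : 0 ≤ volume.real K.carrier := measureReal_nonneg
      positivity
    have heq : 1 / N * (volume.real K.carrier * (τ⁻¹ * (X₁.p K - X₀.p K) * X₁.p K))
        - 1 / (2 * N) * (volume.real K.carrier * X₁.p K ^ 2
          - volume.real K.carrier * X₀.p K ^ 2) * τ⁻¹
        = 1 / (2 * N) * volume.real K.carrier * τ⁻¹ * (X₁.p K - X₀.p K) ^ 2 := by
      field_simp
      ring
    linarith
  have he := mul_le_mul_of_nonneg_left helastic hτ'.le
  have hcomm : ∑ K, volume.real K.carrier * (X₁.p K * (τ⁻¹ * (X₁.φ K - X₀.φ K))) =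
      ∑ K, volume.real K.carrier * (τ⁻¹ * (X₁.φ K - X₀.φ K) * X₁.p K) :=
    Finset.sum_congr rfl fun K _ => by ring
  simp only [← Finset.mul_sum] at hchem
  rw [hcomm] at hpress
  rw [energy_eq, energy_eq]
  linarith

end State

end GasFlow

end

theorem mainTheorem1 (d : ℕ) (hd : 2 ≤ d) (M : ℕ) (F : GasFlow.Mixture M)
    (γ η : ℝ) (hη : 0 < η) (hγ : 0 < 2 * η + d * γ) (κ : ℝ)
    (m ϱ : ℝ) (hm : 0 < m) (hϱ : ϱ < 1) :
    ∃ ςstar θstar : ℝ,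
      ∀ (T : GasFlow.Mesh d) (_ : T.ShapeRegular κ) (P : GasFlow.Transport T M)
        (a N ς ς₁ : ℝ) (_ : 0 < N) (_ : 0 ≤ ς) (_ : ςstar ≤ ς₁)
        (τ θ : ℕ → ℝ) (X : ℕ → GasFlow.State T M) (n : ℕ),
        0 < τ n → θstar ≤ θ n →
        (X n).Bounded F m ϱ → (X (n + 1)).Bounded F m ϱ →
        GasFlow.State.IsStep F P γ η a N ς ς₁ (τ n) (θ n) (X n) (X (n + 1)) →
        GasFlow.Dτ (τ n) ((X (n + 1)).energy F γ η N ς₁) ((X n).energy F γ η N ς₁) ≤ 0 := by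
  obtain ⟨θstar, hθstar⟩ := F.exists_stabilization hm hϱ
  refine ⟨GasFlow.Mesh.penaltyThreshold d γ η κ, θstar, ?_⟩
  intro T hT P a N ς ς₁ hN hς hς₁ τ θ X n hτ hθ h₀ h₁ hstep
  refine hstep.energy_le hd hN hς hτ (fun K i => hm.trans_le ((h₀ K).2.1 i))
    (fun K => (h₁ K).1.1) (GasFlow.Mesh.elasticForm_self_nonneg γ η hd hη hγ hT hς₁ _)
    fun K => ?_
  have h := hθstar (θ n) hθ _ (h₁.mem_admissible K) _ (h₀.mem_admissible K)
  rw [GasFlow.State.total_dens] at h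
  exact h
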